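/- Let $\mathcal X,\mathcal Y,\mathcal Z,\mathcal S,\hat{\mathcal S}$ be finite alphabets, $P_S$ a pmf on $\mathcal S$, $P_{YZ|XS}$ a transition law from $\mathcal X\times\mathcal S$ to $\mathcal Y\times\mathcal Z$, with marginals $P_{Y|XS}$ and $P_{Z|XS}$, and $d:\hat{\mathcal S}\times\mathcal S\to\mathbb R$ a distortion function. At blocklength $n$ and rate $R>0$ a code consists of an encoder $\phi^{(n)}:\{1,\dots,\lfloor 2^{nR}\rfloor\}\to\mathcal X^n$, a decoder $g^{(n)}:\mathcal Y^n\to\{1,\dots,\lfloor 2^{nR}\rfloor\}$ and a radar estimator $h^{(n)}:\mathcal X^n\times\mathcal Z^n\to\hat{\mathcal S}^n$. The message $M$ is uniform on $\{1,\dots,\lfloor 2^{nR}\rfloor\}$, the state sequence $S^n$ is i.i.d. with pmf $P_S$ and independent of $M$, $X^n=\phi^{(n)}(M)$, and given $(X^n,S^n)$ the pairs $(Y_i,Z_i)$ are produced memorylessly by $P_{YZ|XS}$. Put $\hat M=g^{(n)}(Y^n)$ and $\hat S^n=h^{(n)}(X^n,Z^n)$. A pair $(R,D)$ with $R>0$,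 $D\in\mathbb R$ is $(\epsilon,\delta)$-achievable if there is a sequence of codes $(\phi^{(n)},g^{(n)},h^{(n)})_n$ with $$\limsup_{n\to\infty}\Pr[\hat M\ne M]\le\epsilon\qquad\text{and}\qquad\limsup_{n\to\infty}\Pr\Big[\tfrac1n\sum_{i=1}^n d(\hat S_i,S_i)>D\Big]\le\delta .$$ Let $\mathcal A_{\epsilon,\delta}\subset\mathbb R^2$ be the set of $(\epsilon,\delta)$-achievable pairs. Let $P_{S|XZ}(s|x,z)=\frac{P_S(s)P_{Z|XS}(z|x,s)}{\sum_{s'}P_S(s')P_{Z|XS}(z|x,s')}$ (with $0/0=0$), and let $\hat s:\mathcal X\times\mathcal Z\to\hat{\mathcal S}$ be any optimal symbol-by-symbol estimator, i.e. $\hat s(x,z)\in\arg\min_{t\in\hat{\mathcal S}}\sum_{s}P_{S|XZ}(s|x,z)\,d(t,s)$ for all $x,z$. Theorem. Let $\epsilon,\delta\ge0$ with $\epsilon+\delta<1$, and let $R>0$, $D\in\mathbb R$. Then $(R,D)$ lies in the closure of $\mathcal A_{\epsilon,\delta}$ if and only if there is a pmf $P_X$ on $\mathcal X$ with $$R\le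 I_{P_XP_SP_{Y|XS}}(X;Y)\qquad\text{and}\qquad D\ge\mathbb E_{P_XP_SP_{Z|XS}}\big[d(\hat s(X,Z),S)\big],$$ where mutual information is measured in bits; and the same equivalence holds with $R=I_{P_XP_SP_{Y|XS}}(X;Y)$ in place of $R\le I_{P_XP_SP_{Y|XS}}(X;Y)$. Moreover, without taking the closure: every $(\epsilon,\delta)$-achievable $(R,D)$ admits a pmf $P_X$ with $R=I_{P_XP_SP_{Y|XS}}(X;Y)$ and $D\ge\mathbb E[d(\hat s(X,Z),S)]$ (strong converse); and $(R,D)$ is $(\epsilon,\delta)$-achievable as soon as some pmf $P_X$ satisfies $R<I_{P_XP_SP_{Y|XS}}(X;Y)$ and $D>\mathbb E[d(\hat s(X,Z),S)]$. -/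

import Mathlib

open Filter

namespace ISAC

noncomputable section

/-- Number of messages at blocklength `n` and rate `R` (in bits per channel use):
the integer part of `2 ^ (n R)`. -/
def numMessages (n : ℕ) (R : ℝ) : ℕ := ⌊(2 : ℝ) ^ ((n : ℝ) * R)⌋₊

/-- The conditional pmf of `Y` given `X, S`, a marginal of the channel law `W(y, z | x, s)`. -/
def chanY {X Y Z S : Type*} [Fintype Z] (W : X → S → Y × Z → ℝ) (x : X) (s : S) (y : Y) : ℝ :=
  ∑ z, W x s (y, z)

/-- The conditional pmf of `Z` given `X, S`, a marginal of the channel law `W(y, z | x, s)`. -/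
def chanZ {X Y Z S : Type*} [Fintype Y] (W : X → S → Y × Z → ℝ) (x : X) (s : S) (z : Z) : ℝ :=
  ∑ y, W x s (y, z)

/-- The joint pmf of `(X, Y)` when `X` has pmf `P`, `S` has pmf `PS` and is independent of `X`,
and `Y` is produced by the channel. -/
def jointXY {X Y Z S : Type*} [Fintype Z] [Fintype S] (P : X → ℝ) (PS : S → ℝ)
    (W : X → S → Y × Z → ℝ) (x : X) (y : Y) : ℝ :=
  ∑ s, P x * PS s * chanY W x s y

/-- Mutual information, in bits, of a pair with joint pmf `Q`. -/
def mutualInfo {X Y : Type*} [Fintype X] [Fintype Y] (Q : X → Y → ℝ) : ℝ :=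
  ∑ x, ∑ y, Q x y * Real.logb 2 (Q x y / ((∑ y', Q x y') * (∑ x', Q x' y)))

/-- The posterior pmf of the state given the input and the backscattered signal. -/
def posterior {X Y Z S : Type*} [Fintype Y] [Fintype S] (PS : S → ℝ) (W : X → S → Y × Z → ℝ)
    (s : S) (x : X) (z : Z) : ℝ :=
  PS s * chanZ W x s z / ∑ s', PS s' * chanZ W x s' z

/-- `shat` is an optimal symbol-by-symbol estimator: `shat x z` minimizes the posterior expected
distortion over the reconstruction alphabet. -/
def IsOptimalEstimator {X Y Z S Shat : Type*} [Fintype Y] [Fintype S] (PS : S → ℝ)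
    (W : X → S → Y × Z → ℝ) (d : Shat → S → ℝ) (shat : X → Z → Shat) : Prop :=
  ∀ x z, ∀ t : Shat,
    ∑ s, posterior PS W s x z * d (shat x z) s ≤ ∑ s, posterior PS W s x z * d t s

/-- The expected distortion of the symbol-by-symbol estimator `shat` when `(X, S, Z)` has joint pmf
`P(x) PS(s) P(z | x, s)`. -/
def expDistortion {X Y Z S Shat : Type*} [Fintype X] [Fintype Y] [Fintype Z] [Fintype S]
    (P : X → ℝ) (PS : S → ℝ) (W : X → S → Y × Z → ℝ) (d : Shat → S → ℝ) (shat : X → Z → Shat) :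
    ℝ :=
  ∑ x, ∑ s, ∑ z, P x * PS s * chanZ W x s z * d (shat x z) s

/-- The block distortion: average of the per-symbol distortions. -/
def blockDistortion {S Shat : Type*} (d : Shat → S → ℝ) {n : ℕ} (t : Fin n → Shat)
    (s : Fin n → S) : ℝ :=
  (1 / (n : ℝ)) * ∑ i, d (t i) (s i)

open Classical in
/-- The probability of the event `E` about `(M, S^n, Y^n, Z^n)`, when the message `M` is uniform on
`Fin k`, the states are i.i.d. with pmf `PS`, and the channel `W` is used memorylessly with input
sequence `φ M`. -/
def prob {X Y Z S : Type*} [Fintype Y] [Fintype Z] [Fintype S] (PS : S → ℝ)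
    (W : X → S → Y × Z → ℝ) {n k : ℕ} (φ : Fin k → Fin n → X)
    (E : Fin k → (Fin n → S) → (Fin n → Y) → (Fin n → Z) → Prop) : ℝ :=
  ∑ m, ∑ s, ∑ y, ∑ z,
    if E m s y z then (1 / (k : ℝ)) * ∏ i, (PS (s i) * W (φ m i) (s i) (y i, z i)) else 0

/-- The average probability of a decoding error. -/
def errorProb {X Y Z S : Type*} [Fintype Y] [Fintype Z] [Fintype S] (PS : S → ℝ)
    (W : X → S → Y × Z → ℝ) {n k : ℕ} (φ : Fin k → Fin n → X) (g : (Fin n → Y) → Fin k) : ℝ :=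
  prob PS W φ (fun m _ y _ => g y ≠ m)

/-- The probability that the block distortion of the radar's reconstruction exceeds `D`. -/
def excessProb {X Y Z S Shat : Type*} [Fintype Y] [Fintype Z] [Fintype S] (PS : S → ℝ)
    (W : X → S → Y × Z → ℝ) (d : Shat → S → ℝ) (D : ℝ) {n k : ℕ} (φ : Fin k → Fin n → X)
    (h : (Fin n → X) → (Fin n → Z) → Fin n → Shat) : ℝ :=
  prob PS W φ (fun m s _ z => D < blockDistortion d (h (φ m) z) s)

/-- `(R, D)` is `(ε, δ)`-achievable: some sequence of encoders, decoders and radar estimators has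
asymptotic error probability at most `ε` and asymptotic excess-distortion probability at
most `δ`. -/
def Achievable {X Y Z S Shat : Type*} [Fintype Y] [Fintype Z] [Fintype S] (PS : S → ℝ)
    (W : X → S → Y × Z → ℝ) (d : Shat → S → ℝ) (ε δ R D : ℝ) : Prop :=
  ∃ (φ : (n : ℕ) → Fin (numMessages n R) → Fin n → X)
    (g : (n : ℕ) → (Fin n → Y) → Fin (numMessages n R))
    (h : (n : ℕ) → (Fin n → X) → (Fin n → Z) → Fin n → Shat),
    limsup (fun n => errorProb PS W (φ n) (g n)) atTop ≤ ε ∧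
    limsup (fun n => excessProb PS W d D (φ n) (h n)) atTop ≤ δ

/-- The set of `(ε, δ)`-achievable pairs `(R, D)` with positive rate. -/
def achievableSet {X Y Z S Shat : Type*} [Fintype Y] [Fintype Z] [Fintype S] (PS : S → ℝ)
    (W : X → S → Y × Z → ℝ) (d : Shat → S → ℝ) (ε δ : ℝ) : Set (ℝ × ℝ) :=
  {p | 0 < p.1 ∧ Achievable PS W d ε δ p.1 p.2}

end

end ISAC

/-! The error event depends only on (M, Yⁿ) and the excess event only on (M, Sⁿ, Zⁿ). After summing
out the other variables, decoding takes place over the memoryless channel `avgChan`. Distortion is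
governed, codeword by codeword, by the average over the letters of the additive input cost c(x) =
E[d(ŝ(x,Z),S) | X=x] (`inputCost`).

Converse. Fix η > 0 and split the codewords by average input cost. If the cost is at least D + 2η,
then every estimator exceeds D with probability 1 - O(1/n): given Zⁿ the states are independent with
the posterior laws, and letter by letter no reconstruction has smaller posterior cost than ŝ
(`nonexcess_le`). If the cost is below D + 2η, the type of the codeword is an admissible input pmf,
with mutual information at most some r. A change of measure to the output law of that type, together
with disjointness of the decoding regions and the polynomial number of types, bounds the total
success probability of these codewords by k·o(1) + poly(n)·2^{n(r+η)} (`sum_success_le`). So costly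
codewords pay in excess distortion and cheap ones in decoding error. Adding up gives error + excess
≥ 1 - o(1) when r = R - 2η, which contradicts ε + δ < 1 (`one_le_errorProb_add_excessProb`).
Compactness of the simplex lets η tend to 0.

Achievability. Feinstein's greedy construction is restricted to codewords of nearly average cost
(`exists_feinstein_code`). It makes the error small for every message, and ŝ applied letter by
letter keeps the distortion of each codeword below D by Chebyshev's inequality (`excess_le`).

Equality in the rate condition comes from sliding the input pmf towards a point mass at the cheapest
letter: the cost does not rise, and the mutual information reaches R on its way down to 0. -/

namespace ISAC

noncomputable section

/-! ### Product pmfs and Chebyshev's inequality. -/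

section Concentration

variable {A B C : Type*} [Fintype A] [Fintype B] [Fintype C] {n : ℕ}

theorem sum_prod_eq_prod_sum (p : Fin n → A → ℝ) :
    ∑ a : Fin n → A, ∏ i, p i (a i) = ∏ i, ∑ a, p i a := by
  classical
  rw [Finset.prod_univ_sum, Fintype.piFinset_univ]

theorem sum_sum_prod_eq_prod_sum_sum (p : Fin n → A → B → ℝ) :
    ∑ a : Fin n → A, ∑ b : Fin n → B, ∏ i, p i (a i) (b i) = ∏ i, ∑ a, ∑ b, p i a b := by
  rw [← sum_prod_eq_prod_sum]
  exact Finset.sum_congr rfl fun a _ => sum_prod_eq_prod_sum fun i => p i (a i)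

theorem sum_prod_eq_one {p : Fin n → A → ℝ} (hp : ∀ i, p i ∈ stdSimplex ℝ A) :
    ∑ a : Fin n → A, ∏ i, p i (a i) = 1 := by
  rw [sum_prod_eq_prod_sum]
  exact Finset.prod_eq_one fun i _ => (hp i).2

theorem prod_pmf_nonneg {p : Fin n → A → ℝ} (hp : ∀ i, p i ∈ stdSimplex ℝ A) (a : Fin n → A) :
    0 ≤ ∏ i, p i (a i) :=
  Finset.prod_nonneg fun i _ => (hp i).1 _

theorem sum_fin_succ_pi (F : (Fin (n + 1) → A) → ℝ) :
    ∑ a, F a = ∑ a₀ : A, ∑ a : Fin n → A, F (Fin.cons a₀ a) := by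
  rw [← (Fin.consEquiv (fun _ : Fin (n + 1) => A)).sum_comp, Fintype.sum_prod_type]
  rfl

/-- Induction on the number of coordinates, splitting off the first. Expanding the square leaves a
cross term containing the first moment of the remaining sum, so both moments are carried together.
-/
theorem first_second_moment (p g : Fin n → A → ℝ) (hp : ∀ i, ∑ a, p i a = 1)
    (hg : ∀ i, ∑ a, p i a * g i a = 0) :
    ∑ a : Fin n → A, (∏ i, p i (a i)) * ∑ i, g i (a i) = 0 ∧
    ∑ a : Fin n → A, (∏ i, p i (a i)) * (∑ i, g i (a i)) ^ 2 =
      ∑ i, ∑ a, p i a * g i a ^ 2 := by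
  induction n with
  | zero => simp
  | succ n ih =>
    obtain ⟨h1, h2⟩ := ih (fun i => p i.succ) (fun i => g i.succ) (fun i => hp _) (fun i => hg _)
    have h0 : ∑ a : Fin n → A, ∏ i, p i.succ (a i) = 1 := by
      rw [sum_prod_eq_prod_sum (fun i => p i.succ)]
      exact Finset.prod_eq_one fun i _ => hp _
    simp only [sum_fin_succ_pi, Fin.prod_univ_succ, Fin.sum_univ_succ, Fin.cons_zero,
      Fin.cons_succ]
    constructor
    · have : ∀ a₀ : A, ∑ a : Fin n → A, p 0 a₀ * (∏ i, p i.succ (a i)) *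
          (g 0 a₀ + ∑ i, g i.succ (a i)) = p 0 a₀ * g 0 a₀ := by
        intro a₀
        calc _ = p 0 a₀ * g 0 a₀ * ∑ a : Fin n → A, ∏ i, p i.succ (a i) +
              p 0 a₀ * ∑ a : Fin n → A, (∏ i, p i.succ (a i)) * ∑ i, g i.succ (a i) := by
              rw [Finset.mul_sum, Finset.mul_sum, ← Finset.sum_add_distrib]
              exact Finset.sum_congr rfl fun a _ => by ring
          _ = _ := by rw [h0, h1]; ring
      simp only [this, hg]
    · have : ∀ a₀ : A, ∑ a : Fin n → A, p 0 a₀ * (∏ i, p i.succ (a i)) *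
          (g 0 a₀ + ∑ i, g i.succ (a i)) ^ 2 = p 0 a₀ * g 0 a₀ ^ 2 +
            p 0 a₀ * ∑ i : Fin n, ∑ a, p i.succ a * g i.succ a ^ 2 := by
        intro a₀
        calc _ = p 0 a₀ * g 0 a₀ ^ 2 * ∑ a : Fin n → A, ∏ i, p i.succ (a i) +
              2 * p 0 a₀ * g 0 a₀ *
                ∑ a : Fin n → A, (∏ i, p i.succ (a i)) * ∑ i, g i.succ (a i) +
              p 0 a₀ * ∑ a : Fin n → A, (∏ i, p i.succ (a i)) * (∑ i, g i.succ (a i)) ^ 2 := by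
              rw [Finset.mul_sum, Finset.mul_sum, Finset.mul_sum, ← Finset.sum_add_distrib,
                ← Finset.sum_add_distrib]
              exact Finset.sum_congr rfl fun a _ => by ring
          _ = _ := by rw [h0, h1, h2]; ring
      simp only [this, Finset.sum_add_distrib, ← Finset.sum_mul, hp, one_mul]

/-- Chebyshev's inequality for sums of independent bounded variables on finite alphabets. -/
theorem chebyshev_prod_pmf {p : Fin n → A → ℝ} (hp : ∀ i, p i ∈ stdSimplex ℝ A)
    (f : Fin n → A → ℝ) {b η : ℝ} (hf : ∀ i a, |f i a| ≤ b) (hη : 0 < η) (hn : 0 < n)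
    (E : (Fin n → A) → Prop) [DecidablePred E]
    (hE : ∀ a, E a → n * η ≤ |∑ i, f i (a i) - ∑ i, ∑ a, p i a * f i a|) :
    ∑ a, (if E a then ∏ i, p i (a i) else 0) ≤ b ^ 2 / (n * η ^ 2) := by
  have hn' : (0 : ℝ) < n := by exact_mod_cast hn
  set μ : Fin n → ℝ := fun i => ∑ a, p i a * f i a with hμ
  obtain ⟨-, h2⟩ := first_second_moment p (fun i a => f i a - μ i) (fun i => (hp i).2) (by
    intro i
    simp only [mul_sub, Finset.sum_sub_distrib, ← Finset.sum_mul, (hp i).2, one_mul, hμ, sub_self])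
  have hvar : ∀ i, ∑ a, p i a * (f i a - μ i) ^ 2 ≤ b ^ 2 := by
    intro i
    have h : ∑ a, p i a * (f i a - μ i) ^ 2 = ∑ a, p i a * f i a ^ 2 - μ i ^ 2 := by
      have : ∀ a, p i a * (f i a - μ i) ^ 2 =
          p i a * f i a ^ 2 - 2 * μ i * (p i a * f i a) + p i a * μ i ^ 2 := fun a => by ring
      simp only [this, Finset.sum_add_distrib, Finset.sum_sub_distrib, ← Finset.sum_mul,
        ← Finset.mul_sum, (hp i).2]
      change _ - 2 * μ i * μ i + _ = _
      ring
    have h' : ∑ a, p i a * f i a ^ 2 ≤ ∑ a, p i a * b ^ 2 :=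
      Finset.sum_le_sum fun a _ => mul_le_mul_of_nonneg_left
        (sq_le_sq' (abs_le.1 (hf i a)).1 (abs_le.1 (hf i a)).2) ((hp i).1 a)
    rw [← Finset.sum_mul, (hp i).2, one_mul] at h'
    rw [h]
    nlinarith [sq_nonneg (μ i)]
  have hsum : ∑ i, ∑ a, p i a * (f i a - μ i) ^ 2 ≤ n * b ^ 2 := by
    refine (Finset.sum_le_sum fun i _ => hvar i).trans ?_
    simp
  rw [← h2] at hsum
  -- Markov's inequality for the squared deviation.
  have hmark : (n * η) ^ 2 * ∑ a, (if E a then ∏ i, p i (a i) else 0) ≤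
      ∑ a : Fin n → A, (∏ i, p i (a i)) * (∑ i, (f i (a i) - μ i)) ^ 2 := by
    rw [Finset.mul_sum]
    refine Finset.sum_le_sum fun a _ => ?_
    have hpa := prod_pmf_nonneg hp a
    split_ifs with h
    · rw [mul_comm]
      refine mul_le_mul_of_nonneg_left ?_ hpa
      have := hE a h
      rw [Finset.sum_sub_distrib]
      calc (n * η) ^ 2 ≤ |∑ i, f i (a i) - ∑ i, μ i| ^ 2 := by gcongr
        _ = _ := sq_abs _
    · rw [mul_zero]
      exact mul_nonneg hpa (sq_nonneg _)
  rw [le_div_iff₀ (by positivity)]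
  have := hmark.trans hsum
  have h3 : n * ((∑ a, (if E a then ∏ i, p i (a i) else 0)) * (n * η ^ 2)) ≤ n * b ^ 2 := by
    linarith
  exact le_of_mul_le_mul_left h3 hn'

/-- A weight on a finite type is at most its restriction to `E` plus its restriction to the
complement. -/
theorem sum_eq_sum_ite_add_sum_ite_not (E : A → Prop) [DecidablePred E] (w : A → ℝ) :
    ∑ a, w a = ∑ a, (if E a then w a else 0) + ∑ a, (if ¬ E a then w a else 0) := by
  rw [← Finset.sum_add_distrib]
  exact Finset.sum_congr rfl fun a _ => by by_cases h : E a <;> simp [h]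

end Concentration

/-! ### Marginal channels and the two error criteria. -/

section Channel

variable {X Y Z S Shat : Type*}

variable [Fintype Z] [Fintype S]

/-- The channel from `X` to `Y` obtained by averaging over the state. -/
def avgChan (PS : S → ℝ) (W : X → S → Y × Z → ℝ) (x : X) (y : Y) : ℝ :=
  ∑ s, PS s * chanY W x s y

theorem jointXY_eq (P : X → ℝ) (PS : S → ℝ) (W : X → S → Y × Z → ℝ) :
    jointXY P PS W = fun x y => P x * avgChan PS W x y := by
  funext x y
  simp only [jointXY, avgChan, Finset.mul_sum, mul_assoc]

variable [Fintype Y]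

/-- The conditional expectation of the distortion given the input, for the symbol-by-symbol
estimator `shat`. -/
def inputCost (PS : S → ℝ) (W : X → S → Y × Z → ℝ) (d : Shat → S → ℝ) (shat : X → Z → Shat)
    (x : X) : ℝ :=
  ∑ s, ∑ z, PS s * chanZ W x s z * d (shat x z) s

theorem expDistortion_eq [Fintype X] (P : X → ℝ) (PS : S → ℝ) (W : X → S → Y × Z → ℝ)
    (d : Shat → S → ℝ)
    (shat : X → Z → Shat) :
    expDistortion P PS W d shat = ∑ x, P x * inputCost PS W d shat x := by
  simp only [expDistortion, inputCost, Finset.mul_sum, mul_assoc]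

theorem chanY_mem_stdSimplex {T : Type*} {W : X → T → Y × Z → ℝ} (hW : ∀ x s, W x s ∈ stdSimplex ℝ
    (Y × Z))
    (x : X) (s : T) : chanY W x s ∈ stdSimplex ℝ Y := by
  refine ⟨fun y => Finset.sum_nonneg fun z _ => (hW x s).1 _, ?_⟩
  simp only [chanY, ← Fintype.sum_prod_type]
  exact (hW x s).2

theorem chanZ_mem_stdSimplex {T : Type*} {W : X → T → Y × Z → ℝ} (hW : ∀ x s, W x s ∈ stdSimplex ℝ
    (Y × Z))
    (x : X) (s : T) : chanZ W x s ∈ stdSimplex ℝ Z := by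
  refine ⟨fun y => Finset.sum_nonneg fun z _ => (hW x s).1 _, ?_⟩
  simp only [chanZ, ← Fintype.sum_prod_type_right]
  exact (hW x s).2

theorem avgChan_mem_stdSimplex {PS : S → ℝ} (hPS : PS ∈ stdSimplex ℝ S) {W : X → S → Y × Z → ℝ}
    (hW : ∀ x s, W x s ∈ stdSimplex ℝ (Y × Z)) (x : X) : avgChan PS W x ∈ stdSimplex ℝ Y := by
  refine ⟨fun y => Finset.sum_nonneg fun s _ =>
    mul_nonneg (hPS.1 s) ((chanY_mem_stdSimplex hW x s).1 y), ?_⟩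
  simp only [avgChan]
  rw [Finset.sum_comm]
  simp only [← Finset.mul_sum, (chanY_mem_stdSimplex hW x _).2, mul_one, hPS.2]

theorem stateSignal_mem_stdSimplex {PS : S → ℝ} (hPS : PS ∈ stdSimplex ℝ S)
    {W : X → S → Y × Z → ℝ} (hW : ∀ x s, W x s ∈ stdSimplex ℝ (Y × Z)) (x : X) :
    (fun q : S × Z => PS q.1 * chanZ W x q.1 q.2) ∈ stdSimplex ℝ (S × Z) := by
  refine ⟨fun q => mul_nonneg (hPS.1 _) ((chanZ_mem_stdSimplex hW x _).1 _), ?_⟩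
  rw [Fintype.sum_prod_type]
  simp only [← Finset.mul_sum, (chanZ_mem_stdSimplex hW x _).2, mul_one, hPS.2]

-- The event does not involve the states or `z`, so their sums factor over the coordinates and leave
-- the averaged channel.
open Classical in
theorem errorProb_eq (PS : S → ℝ) (W : X → S → Y × Z → ℝ) {n k : ℕ} (φ : Fin k → Fin n → X)
    (g : (Fin n → Y) → Fin k) :
    errorProb PS W φ g = 1 / (k : ℝ) *
      ∑ m, ∑ y : Fin n → Y, if g y ≠ m then ∏ i, avgChan PS W (φ m i) (y i) else 0 := by
  simp only [errorProb, prob]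
  rw [Finset.mul_sum]
  refine Finset.sum_congr rfl fun m _ => ?_
  rw [Finset.sum_comm, Finset.mul_sum]
  refine Finset.sum_congr rfl fun y _ => ?_
  by_cases h : g y ≠ m
  · simp only [if_pos h, ← Finset.mul_sum]
    rw [sum_sum_prod_eq_prod_sum_sum fun i s z => PS s * W (φ m i) s (y i, z)]
    simp only [avgChan, chanY, Finset.mul_sum]
  · simp [if_neg h]

-- Here the sum over `y` factors out, leaving the joint law of states and backscattered signal.
open Classical in
theorem excessProb_eq (PS : S → ℝ) (W : X → S → Y × Z → ℝ) (d : Shat → S → ℝ) (D : ℝ) {n k : ℕ}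
    (φ : Fin k → Fin n → X) (h : (Fin n → X) → (Fin n → Z) → Fin n → Shat) :
    excessProb PS W d D φ h = 1 / (k : ℝ) *
      ∑ m, ∑ s : Fin n → S, ∑ z : Fin n → Z, if D < blockDistortion d (h (φ m) z) s then
        ∏ i, (PS (s i) * chanZ W (φ m i) (s i) (z i)) else 0 := by
  simp only [excessProb, prob]
  rw [Finset.mul_sum]
  refine Finset.sum_congr rfl fun m _ => ?_
  rw [Finset.mul_sum]
  refine Finset.sum_congr rfl fun s _ => ?_
  rw [Finset.sum_comm, Finset.mul_sum]
  refine Finset.sum_congr rfl fun z _ => ?_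
  by_cases h : D < blockDistortion d (h (φ m) z) s
  · simp only [if_pos h, ← Finset.mul_sum]
    rw [sum_prod_eq_prod_sum fun i y => PS (s i) * W (φ m i) (s i) (y, z i)]
    simp only [chanZ, Finset.mul_sum]
  · simp [if_neg h]

end Channel

/-! ### Mutual information and information density. -/

section MutualInfo

variable {X Y : Type*} [Fintype X] [Fintype Y]

/-- The output pmf of the channel `V` when the input has pmf `P`. -/
def outputLaw (P : X → ℝ) (V : X → Y → ℝ) (y : Y) : ℝ := ∑ x, P x * V x y

/-- The information density, in bits, of input `x` and output `y`. -/
def infoDensity (P : X → ℝ) (V : X → Y → ℝ) (x : X) (y : Y) : ℝ :=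
  Real.logb 2 (V x y / outputLaw P V y)

theorem mutualInfo_eq_sum_infoDensity (P : X → ℝ) {V : X → Y → ℝ} (hV : ∀ x, ∑ y, V x y = 1) :
    mutualInfo (fun x y => P x * V x y) = ∑ x, ∑ y, P x * V x y * infoDensity P V x y := by
  simp only [mutualInfo, infoDensity, outputLaw, ← Finset.mul_sum, hV, mul_one]
  refine Finset.sum_congr rfl fun x _ => Finset.sum_congr rfl fun y _ => ?_
  by_cases h : P x = 0
  · simp [h]
  · rw [mul_div_mul_left _ _ h]

theorem outputLaw_mem_stdSimplex {P : X → ℝ} (hP : P ∈ stdSimplex ℝ X) {V : X → Y → ℝ}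
    (hV : ∀ x, V x ∈ stdSimplex ℝ Y) : outputLaw P V ∈ stdSimplex ℝ Y := by
  refine ⟨fun y => Finset.sum_nonneg fun x _ => mul_nonneg (hP.1 x) ((hV x).1 y), ?_⟩
  simp only [outputLaw]
  rw [Finset.sum_comm]
  simp only [← Finset.mul_sum, (hV _).2, mul_one, hP.2]

theorem mul_le_outputLaw {P : X → ℝ} (hP : P ∈ stdSimplex ℝ X) {V : X → Y → ℝ}
    (hV : ∀ x, V x ∈ stdSimplex ℝ Y) (x : X) (y : Y) : P x * V x y ≤ outputLaw P V y :=
  Finset.single_le_sum (f := fun x => P x * V x y)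
    (fun x _ => mul_nonneg (hP.1 x) ((hV x).1 y)) (Finset.mem_univ x)

/-- Every term has the form t log t, which is continuous at 0 as well. This gives continuity of the
mutual information up to the boundary of the simplex. -/
theorem mutualInfo_eq_entropies {Q : X → Y → ℝ} (hQ : ∀ x y, 0 ≤ Q x y) :
    mutualInfo Q = (∑ x, ∑ y, Q x y * Real.log (Q x y) -
      ∑ x, (∑ y, Q x y) * Real.log (∑ y, Q x y) -
      ∑ y, (∑ x, Q x y) * Real.log (∑ x, Q x y)) / Real.log 2 := by
  have key : ∀ x y, Q x y * Real.logb 2 (Q x y / ((∑ y', Q x y') * (∑ x', Q x' y))) =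
      (Q x y * Real.log (Q x y) - Q x y * Real.log (∑ y', Q x y') -
        Q x y * Real.log (∑ x', Q x' y)) / Real.log 2 := by
    intro x y
    rcases (hQ x y).eq_or_lt with h | h
    · simp [← h]
    · have h1 : 0 < ∑ y', Q x y' :=
        h.trans_le (Finset.single_le_sum (fun y _ => hQ x y) (Finset.mem_univ y))
      have h2 : 0 < ∑ x', Q x' y :=
        h.trans_le (Finset.single_le_sum (f := fun x => Q x y) (fun x _ => hQ x y)
          (Finset.mem_univ x))
      rw [Real.logb, Real.log_div h.ne' (mul_pos h1 h2).ne', Real.log_mul h1.ne' h2.ne']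
      ring
  simp only [mutualInfo, key, ← Finset.sum_div, Finset.sum_sub_distrib]
  congr 2
  · simp only [Finset.sum_mul]
  · rw [Finset.sum_comm]
    simp only [Finset.sum_mul]

theorem continuousOn_mutualInfo {V : X → Y → ℝ} (hV : ∀ x, V x ∈ stdSimplex ℝ Y) :
    ContinuousOn (fun P : X → ℝ => mutualInfo fun x y => P x * V x y) (stdSimplex ℝ X) := by
  have hlog := Real.continuous_mul_log
  have : Continuous fun P : X → ℝ =>
      (∑ x, ∑ y, P x * V x y * Real.log (P x * V x y) -
      ∑ x, (∑ y, P x * V x y) * Real.log (∑ y, P x * V x y) -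
      ∑ y, (∑ x, P x * V x y) * Real.log (∑ x, P x * V x y)) / Real.log 2 := by
    refine Continuous.div_const (Continuous.sub (Continuous.sub ?_ ?_) ?_) _
    · exact continuous_finsetSum _ fun x _ => continuous_finsetSum _ fun y _ =>
        hlog.comp (g := fun t : ℝ => t * Real.log t) (by fun_prop)
    · exact continuous_finsetSum _ fun x _ =>
        hlog.comp (g := fun t : ℝ => t * Real.log t) (by fun_prop)
    · exact continuous_finsetSum _ fun y _ =>
        hlog.comp (g := fun t : ℝ => t * Real.log t) (by fun_prop)
  refine this.continuousOn.congr fun P hP => ?_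
  exact mutualInfo_eq_entropies fun x y => mul_nonneg (hP.1 x) ((hV x).1 y)

theorem mutualInfo_single [DecidableEq X] (x₀ : X) {V : X → Y → ℝ}
    (hV : ∀ x, V x ∈ stdSimplex ℝ Y) :
    mutualInfo (fun x y => (Pi.single x₀ 1 : X → ℝ) x * V x y) = 0 := by
  rw [mutualInfo_eq_sum_infoDensity _ fun x => (hV x).2]
  refine Finset.sum_eq_zero fun x _ => Finset.sum_eq_zero fun y _ => ?_
  by_cases h : x = x₀
  · subst h
    have : outputLaw (Pi.single x 1) V y = V x y := by
      simp [outputLaw, Pi.single_apply]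
    rw [infoDensity, this]
    by_cases h0 : V x y = 0
    · simp [h0]
    · simp [div_self h0]
  · simp [h]

/-- A memoryless product of channel probabilities, rewritten through the information density. -/
theorem prod_le_rpow_sum_infoDensity {P : X → ℝ} {V : X → Y → ℝ}
    (hV : ∀ x, V x ∈ stdSimplex ℝ Y) {n : ℕ} (x : Fin n → X) (y : Fin n → Y)
    (hq : ∀ i, V (x i) (y i) ≠ 0 → 0 < outputLaw P V (y i))
    (hq0 : ∀ y, 0 ≤ outputLaw P V y) :
    ∏ i, V (x i) (y i) ≤
      (2 : ℝ) ^ (∑ i, infoDensity P V (x i) (y i)) * ∏ i, outputLaw P V (y i) := by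
  -- At a zero transition probability `infoDensity` takes the default value 0 and the exponential
  -- identity fails, but then the left side is 0.
  by_cases h : ∀ i, V (x i) (y i) ≠ 0
  · rw [Real.rpow_sum_of_pos two_pos, ← Finset.prod_mul_distrib]
    refine (Finset.prod_congr rfl fun i _ => ?_).le
    have h1 : 0 < V (x i) (y i) := lt_of_le_of_ne ((hV _).1 _) (h i).symm
    rw [infoDensity, Real.rpow_logb two_pos (by norm_num) (div_pos h1 (hq i (h i))),
      div_mul_cancel₀ _ (hq i (h i)).ne']
  · push Not at h
    obtain ⟨i, hi⟩ := h
    rw [Finset.prod_eq_zero (Finset.mem_univ i) hi]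
    exact mul_nonneg (Real.rpow_nonneg two_pos.le _) (Finset.prod_nonneg fun i _ => hq0 _)

/-- Conversely, on outputs of positive probability the channel product is at least the
exponential of the information density times the output probability. -/
theorem prod_outputLaw_le {P : X → ℝ} {V : X → Y → ℝ}
    (hV : ∀ x, V x ∈ stdSimplex ℝ Y) (hq : ∀ y, 0 ≤ outputLaw P V y)
    {n : ℕ} {x : Fin n → X} {y : Fin n → Y}
    (hxy : ∀ i, V (x i) (y i) ≠ 0) {t : ℝ} (ht : t ≤ ∑ i, infoDensity P V (x i) (y i)) :
    ∏ i, outputLaw P V (y i) ≤ (2 : ℝ) ^ (-t) * ∏ i, V (x i) (y i) := by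
  -- If some output letter has probability zero the left side vanishes, so `P` need not charge the
  -- letters of `x`.
  by_cases h : ∀ i, outputLaw P V (y i) ≠ 0
  · have h1 : ∏ i, V (x i) (y i) =
        (2 : ℝ) ^ (∑ i, infoDensity P V (x i) (y i)) * ∏ i, outputLaw P V (y i) := by
      rw [Real.rpow_sum_of_pos two_pos, ← Finset.prod_mul_distrib]
      refine Finset.prod_congr rfl fun i _ => ?_
      have hv : 0 < V (x i) (y i) := lt_of_le_of_ne ((hV _).1 _) (hxy i).symm
      have hqi : 0 < outputLaw P V (y i) := lt_of_le_of_ne (hq _) (h i).symm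
      rw [infoDensity, Real.rpow_logb two_pos (by norm_num) (div_pos hv hqi),
        div_mul_cancel₀ _ hqi.ne']
    rw [h1, ← mul_assoc, ← Real.rpow_add two_pos]
    refine le_mul_of_one_le_left (Finset.prod_nonneg fun i _ => hq _) ?_
    exact Real.one_le_rpow one_le_two (by linarith)
  · push Not at h
    obtain ⟨i, hi⟩ := h
    rw [Finset.prod_eq_zero (Finset.mem_univ i) hi]
    exact mul_nonneg (Real.rpow_nonneg two_pos.le _) (Finset.prod_nonneg fun i _ => (hV _).1 _)

end MutualInfo

/-! ### Types and the strong converse for the channel. -/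

section Types

variable {X Y : Type*} {n : ℕ}

open Classical in
/-- The type (empirical distribution) of a sequence. -/
def empType (x : Fin n → X) (a : X) : ℝ := (∑ i, if x i = a then (1 : ℝ) else 0) / n

theorem one_div_le_empType (x : Fin n → X) (i : Fin n) : 1 / (n : ℝ) ≤ empType x (x i) := by
  classical
  unfold empType
  gcongr
  have := Finset.single_le_sum (f := fun j => if x j = x i then (1 : ℝ) else 0)
    (fun j _ => by split_ifs <;> simp) (Finset.mem_univ i)
  simpa using this

variable [Fintype X] [Fintype Y]

theorem sum_empType_mul (x : Fin n → X) (F : X → ℝ) :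
    ∑ a, empType x a * F a = (∑ i, F (x i)) / n := by
  classical
  simp only [empType, div_mul_eq_mul_div, ← Finset.sum_div, Finset.sum_mul]
  rw [Finset.sum_comm]
  simp

theorem empType_mem_stdSimplex (hn : 0 < n) (x : Fin n → X) : empType x ∈ stdSimplex ℝ X := by
  refine ⟨fun a => div_nonneg (Finset.sum_nonneg fun i _ => by split_ifs <;> simp)
    (Nat.cast_nonneg n), ?_⟩
  have h := sum_empType_mul x fun _ => (1 : ℝ)
  have hn' : (n : ℝ) ≠ 0 := by exact_mod_cast hn.ne'
  simpa [hn'] using h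

open Classical in
/-- There are at most polynomially many types. -/
theorem card_image_empType_le (n : ℕ) :
    ((Finset.univ : Finset (Fin n → X)).image empType).card ≤ (n + 1) ^ Fintype.card X := by
  -- A type is determined by its letter counts, each in {0, …, n}.
  have hsub : (Finset.univ : Finset (Fin n → X)).image empType ⊆
      (Finset.univ : Finset (X → Fin (n + 1))).image fun c a => ((c a : ℕ) : ℝ) / n := by
    intro P hP
    obtain ⟨x, -, rfl⟩ := Finset.mem_image.1 hP
    refine Finset.mem_image.2 ⟨fun a => ⟨(Finset.univ.filter fun i => x i = a).card, ?_⟩,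
      Finset.mem_univ _, ?_⟩
    · exact Nat.lt_succ_of_le ((Finset.card_filter_le _ _).trans (by simp))
    · funext a
      simp [empType]
  refine (Finset.card_le_card hsub).trans (Finset.card_image_le.trans ?_)
  simp

/-- A bound on the logarithms of the positive transition probabilities of `V`. -/
def logBound (V : X → Y → ℝ) : ℝ := ∑ x, ∑ y, |Real.logb 2 (V x y)|

theorem logBound_nonneg (V : X → Y → ℝ) : 0 ≤ logBound V :=
  Finset.sum_nonneg fun _ _ => Finset.sum_nonneg fun _ _ => abs_nonneg _

theorem abs_logb_le_logBound (V : X → Y → ℝ) (x : X) (y : Y) :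
    |Real.logb 2 (V x y)| ≤ logBound V :=
  (Finset.single_le_sum (f := fun y => |Real.logb 2 (V x y)|) (fun _ _ => abs_nonneg _)
    (Finset.mem_univ y)).trans (Finset.single_le_sum
      (f := fun x => ∑ y, |Real.logb 2 (V x y)|)
      (fun _ _ => Finset.sum_nonneg fun _ _ => abs_nonneg _) (Finset.mem_univ x))

/-- A letter of the codeword has mass at least 1/n in its type, so the likelihood ratio is at most
n; from below, the output probability is at most 1. The bound grows with n, but only
logarithmically, so its square divided by n still tends to 0 in Chebyshev's inequality. -/
theorem abs_infoDensity_empType_le {V : X → Y → ℝ} (hV : ∀ x, V x ∈ stdSimplex ℝ Y) (hn : 0 < n)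
    (x : Fin n → X) (i : Fin n) (y : Y) :
    |infoDensity (empType x) V (x i) y| ≤ logBound V + Real.logb 2 n := by
  have hn' : (1 : ℝ) ≤ n := by exact_mod_cast hn
  have hlogn : 0 ≤ Real.logb 2 n := Real.logb_nonneg one_lt_two hn'
  have hP := empType_mem_stdSimplex hn x
  rcases ((hV (x i)).1 y).eq_or_lt with h0 | h0
  · simp only [infoDensity, ← h0, zero_div, Real.logb_zero, abs_zero]
    exact add_nonneg (logBound_nonneg V) hlogn
  have hq1 : 1 / (n : ℝ) * V (x i) y ≤ outputLaw (empType x) V y :=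
    (mul_le_mul_of_nonneg_right (one_div_le_empType x i) h0.le).trans (mul_le_outputLaw hP hV _ _)
  have hq0 : 0 < outputLaw (empType x) V y := lt_of_lt_of_le (by positivity) hq1
  have hq2 : outputLaw (empType x) V y ≤ 1 := by
    have h := outputLaw_mem_stdSimplex hP hV
    rw [← h.2]
    exact Finset.single_le_sum (fun y _ => h.1 y) (Finset.mem_univ y)
  have hup : infoDensity (empType x) V (x i) y ≤ Real.logb 2 n := by
    refine Real.logb_le_logb_of_le one_lt_two (by positivity) ?_
    rw [div_le_iff₀ hq0]
    have := mul_le_mul_of_nonneg_left hq1 (Nat.cast_nonneg (α := ℝ) n)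
    rwa [← mul_assoc, mul_one_div_cancel (by positivity), one_mul] at this
  have hlow : Real.logb 2 (V (x i) y) ≤ infoDensity (empType x) V (x i) y := by
    refine Real.logb_le_logb_of_le one_lt_two h0 ?_
    rw [le_div_iff₀ hq0]
    exact mul_le_of_le_one_right h0.le hq2
  have := abs_le.1 (abs_logb_le_logBound V (x i) y)
  have hL := logBound_nonneg V
  rw [abs_le]
  constructor <;> linarith

theorem sum_infoDensity_empType {V : X → Y → ℝ} (hV : ∀ x, V x ∈ stdSimplex ℝ Y) (hn : 0 < n)
    (x : Fin n → X) :
    ∑ i, ∑ y, V (x i) y * infoDensity (empType x) V (x i) y =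
      n * mutualInfo fun a y => empType x a * V a y := by
  rw [mutualInfo_eq_sum_infoDensity _ fun x => (hV x).2]
  have h := sum_empType_mul x fun a => ∑ y, V a y * infoDensity (empType x) V a y
  simp only [Finset.mul_sum, ← mul_assoc] at h
  rw [h, mul_div_cancel₀]
  exact_mod_cast hn.ne'

/-- For a decoding region, the probability under a codeword is at most a Chebyshev term plus an
exponential multiple of the probability under the output law induced by the codeword's type. -/
theorem codeword_success_le {V : X → Y → ℝ} (hV : ∀ x, V x ∈ stdSimplex ℝ Y) (hn : 0 < n)
    (x : Fin n → X) {r η : ℝ} (hη : 0 < η) (hr : mutualInfo (fun a y => empType x a * V a y) ≤ r)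
    (E : (Fin n → Y) → Prop) [DecidablePred E] :
    ∑ y, (if E y then ∏ i, V (x i) (y i) else 0) ≤
      (logBound V + Real.logb 2 n) ^ 2 / (n * η ^ 2) +
        (2 : ℝ) ^ (n * (r + η)) * ∑ y : Fin n → Y,
          if E y then ∏ i, outputLaw (empType x) V (y i) else 0 := by
  classical
  have hP := empType_mem_stdSimplex hn x
  have hq := outputLaw_mem_stdSimplex hP hV
  have hn' : (0 : ℝ) < n := by exact_mod_cast hn
  have hcheb := chebyshev_prod_pmf (fun i => hV (x i))
    (fun i y => infoDensity (empType x) V (x i) y) (abs_infoDensity_empType_le hV hn x) hη hn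
    (fun y => n * (r + η) < ∑ i, infoDensity (empType x) V (x i) (y i)) (by
      intro y hy
      rw [sum_infoDensity_empType hV hn]
      refine le_trans ?_ (le_abs_self _)
      have := mul_le_mul_of_nonneg_left hr hn'.le
      linarith)
  refine le_trans ?_ (add_le_add_left hcheb _)
  rw [Finset.mul_sum, ← Finset.sum_add_distrib]
  refine Finset.sum_le_sum fun y _ => ?_
  have hv0 : 0 ≤ ∏ i, V (x i) (y i) := Finset.prod_nonneg fun i _ => (hV _).1 _
  have hq0 : 0 ≤ ∏ i, outputLaw (empType x) V (y i) := Finset.prod_nonneg fun i _ => hq.1 _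
  have hpow : (0 : ℝ) ≤ 2 ^ (n * (r + η)) := Real.rpow_nonneg two_pos.le _
  by_cases hE : E y
  · simp only [if_pos hE]
    -- Outputs of atypically large information density are paid for by the Chebyshev term; on all
    -- others the change of measure costs at most 2^{n(r+η)}.
    split_ifs with h
    · exact le_add_of_nonneg_right (mul_nonneg hpow hq0)
    · rw [zero_add]
      refine (prod_le_rpow_sum_infoDensity (P := empType x) hV x y (fun i hi => ?_) hq.1).trans ?_
      · refine lt_of_lt_of_le (mul_pos ?_ (lt_of_le_of_ne ((hV _).1 _) hi.symm))
          (mul_le_outputLaw hP hV (x i) (y i))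
        exact lt_of_lt_of_le (by positivity) (one_div_le_empType x i)
      · refine mul_le_mul_of_nonneg_right ?_ hq0
        exact Real.rpow_le_rpow_of_exponent_le one_le_two (not_lt.1 h)
  · simp only [if_neg hE, mul_zero, add_zero]
    split_ifs <;> simp [hv0]

/-- Strong converse bound for codewords whose types have mutual information at most `r`. -/
theorem sum_success_le {V : X → Y → ℝ} (hV : ∀ x, V x ∈ stdSimplex ℝ Y) (hn : 0 < n) {k : ℕ}
    (φ : Fin k → Fin n → X) (g : (Fin n → Y) → Fin k) (G : Finset (Fin k)) {r η : ℝ} (hη : 0 < η)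
    (hr : ∀ m ∈ G, mutualInfo (fun a y => empType (φ m) a * V a y) ≤ r) :
    ∑ m ∈ G, ∑ y : Fin n → Y, (if g y = m then ∏ i, V (φ m i) (y i) else 0) ≤
      k * ((logBound V + Real.logb 2 n) ^ 2 / (n * η ^ 2)) +
        (n + 1 : ℝ) ^ Fintype.card X * (2 : ℝ) ^ (n * (r + η)) := by
  classical
  have hpow : (0 : ℝ) ≤ 2 ^ (n * (r + η)) := Real.rpow_nonneg two_pos.le _
  have hq : ∀ x : Fin n → X, outputLaw (empType x) V ∈ stdSimplex ℝ Y :=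
    fun x => outputLaw_mem_stdSimplex (empType_mem_stdSimplex hn x) hV
  set T := (Finset.univ : Finset (Fin n → X)).image empType with hT
  have hqT : ∀ P ∈ T, outputLaw P V ∈ stdSimplex ℝ Y := by
    intro P hP
    obtain ⟨x, -, rfl⟩ := Finset.mem_image.1 hP
    exact hq x
  have hprod : ∀ P ∈ T, ∀ y : Fin n → Y, 0 ≤ ∏ i, outputLaw P V (y i) :=
    fun P hP y => Finset.prod_nonneg fun i _ => (hqT P hP).1 _
  have hmass : ∑ m ∈ G, ∑ y : Fin n → Y,
      (if g y = m then ∏ i, outputLaw (empType (φ m)) V (y i) else 0) ≤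
        (n + 1 : ℝ) ^ Fintype.card X := by
    -- Replacing the output law of the codeword's own type by the sum over all types makes the
    -- measure independent of `m`. The decoding regions then partition the output space, and each
    -- type contributes mass 1.
    calc _ ≤ ∑ m ∈ G, ∑ y : Fin n → Y, ∑ P ∈ T,
          (if g y = m then ∏ i, outputLaw P V (y i) else 0) := by
          refine Finset.sum_le_sum fun m _ => Finset.sum_le_sum fun y _ => ?_
          refine Finset.single_le_sum
            (f := fun P => if g y = m then ∏ i, outputLaw P V (y i) else 0) (fun P hP => ?_)
            (Finset.mem_image_of_mem _ (Finset.mem_univ (φ m)))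
          split_ifs
          · exact hprod P hP y
          · exact le_rfl
      _ ≤ ∑ m, ∑ y : Fin n → Y, ∑ P ∈ T,
          (if g y = m then ∏ i, outputLaw P V (y i) else 0) := by
          refine Finset.sum_le_sum_of_subset_of_nonneg (Finset.subset_univ _) fun m _ _ => ?_
          refine Finset.sum_nonneg fun y _ => Finset.sum_nonneg fun P hP => ?_
          split_ifs
          · exact hprod P hP y
          · exact le_rfl
      _ = ∑ P ∈ T, ∑ y : Fin n → Y, ∏ i, outputLaw P V (y i) := by
          rw [Finset.sum_comm, Finset.sum_comm (s := T)]
          refine Finset.sum_congr rfl fun y _ => ?_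
          rw [Finset.sum_comm]
          simp
      _ = T.card := by
          rw [Finset.sum_congr rfl fun P hP => sum_prod_eq_one fun _ => hqT P hP]
          simp
      _ ≤ _ := by
          rw [hT]
          exact_mod_cast card_image_empType_le (X := X) n
  refine (Finset.sum_le_sum fun m hm => codeword_success_le hV hn (φ m) hη (hr m hm)
    (fun y => g y = m)).trans ?_
  rw [Finset.sum_add_distrib, ← Finset.mul_sum, Finset.sum_const, nsmul_eq_mul]
  have hn' : (0 : ℝ) < n := by exact_mod_cast hn
  refine add_le_add (mul_le_mul_of_nonneg_right ?_ (by positivity)) ?_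
  · exact_mod_cast (Finset.card_le_univ G).trans (by simp)
  · rw [mul_comm]
    exact mul_le_mul_of_nonneg_right hmass hpow

end Types

/-! ### Optimality of the symbol-by-symbol estimator. -/

section Estimation

variable {X Y Z S Shat : Type*} [Fintype Y] [Fintype Z] [Fintype S]

/-- A bound on the absolute value of the distortion function. -/
def distBound [Fintype Shat] (d : Shat → S → ℝ) : ℝ := ∑ t, ∑ s, |d t s|

theorem distBound_nonneg [Fintype Shat] (d : Shat → S → ℝ) : 0 ≤ distBound d :=
  Finset.sum_nonneg fun _ _ => Finset.sum_nonneg fun _ _ => abs_nonneg _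

theorem abs_le_distBound [Fintype Shat] (d : Shat → S → ℝ) (t : Shat)
    (s : S) : |d t s| ≤ distBound d :=
  (Finset.single_le_sum (f := fun s => |d t s|) (fun _ _ => abs_nonneg _)
    (Finset.mem_univ s)).trans (Finset.single_le_sum (f := fun t => ∑ s, |d t s|)
      (fun _ _ => Finset.sum_nonneg fun _ _ => abs_nonneg _) (Finset.mem_univ t))

theorem abs_sum_mul_le {A : Type*} [Fintype A] {p f : A → ℝ} {b : ℝ} (hp : p ∈ stdSimplex ℝ A)
    (hf : ∀ a, |f a| ≤ b) : |∑ a, p a * f a| ≤ b := by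
  refine (Finset.abs_sum_le_sum_abs _ _).trans ?_
  calc ∑ a, |p a * f a| ≤ ∑ a, p a * b := by
        refine Finset.sum_le_sum fun a _ => ?_
        rw [abs_mul, abs_of_nonneg (hp.1 a)]
        exact mul_le_mul_of_nonneg_left (hf a) (hp.1 a)
    _ = b := by rw [← Finset.sum_mul, hp.2, one_mul]

/-- The conditional pmf of the backscattered signal given the input. -/
def signalLaw (PS : S → ℝ) (W : X → S → Y × Z → ℝ) (x : X) (z : Z) : ℝ :=
  ∑ s, PS s * chanZ W x s z

variable {PS : S → ℝ} {W : X → S → Y × Z → ℝ}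

theorem signalLaw_mem_stdSimplex (hPS : PS ∈ stdSimplex ℝ S)
    (hW : ∀ x s, W x s ∈ stdSimplex ℝ (Y × Z)) (x : X) : signalLaw PS W x ∈ stdSimplex ℝ Z := by
  refine ⟨fun z => Finset.sum_nonneg fun s _ =>
    mul_nonneg (hPS.1 s) ((chanZ_mem_stdSimplex hW x s).1 z), ?_⟩
  simp only [signalLaw]
  rw [Finset.sum_comm]
  simp only [← Finset.mul_sum, (chanZ_mem_stdSimplex hW x _).2, mul_one, hPS.2]

/-- Bayes' rule. With 0/0 = 0 it survives at signals of probability zero, because there every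
nonnegative summand of `signalLaw` is zero. -/
theorem signalLaw_mul_posterior (hPS : PS ∈ stdSimplex ℝ S)
    (hW : ∀ x s, W x s ∈ stdSimplex ℝ (Y × Z)) (x : X) (s : S) (z : Z) :
    signalLaw PS W x z * posterior PS W s x z = PS s * chanZ W x s z := by
  by_cases h : signalLaw PS W x z = 0
  · have h' := (Finset.sum_eq_zero_iff_of_nonneg fun s _ =>
      mul_nonneg (hPS.1 s) ((chanZ_mem_stdSimplex hW x s).1 z)).1 h s (Finset.mem_univ s)
    rw [h, h', zero_mul]
  · exact mul_div_cancel₀ _ h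

theorem posterior_mem_stdSimplex (hPS : PS ∈ stdSimplex ℝ S)
    (hW : ∀ x s, W x s ∈ stdSimplex ℝ (Y × Z)) {x : X} {z : Z} (h : signalLaw PS W x z ≠ 0) :
    (fun s => posterior PS W s x z) ∈ stdSimplex ℝ S := by
  refine ⟨fun s => div_nonneg (mul_nonneg (hPS.1 s) ((chanZ_mem_stdSimplex hW x s).1 z))
    ((signalLaw_mem_stdSimplex hPS hW x).1 z), ?_⟩
  simp only [posterior, ← Finset.sum_div]
  exact div_self h

/-- The posterior expected distortion of the reconstruction symbol `t`. -/
def postCost (PS : S → ℝ) (W : X → S → Y × Z → ℝ) (d : Shat → S → ℝ) (x : X) (z : Z) (t : Shat) :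
    ℝ :=
  ∑ s, posterior PS W s x z * d t s

theorem abs_postCost_le [Fintype Shat] (hPS : PS ∈ stdSimplex ℝ S)
    (hW : ∀ x s, W x s ∈ stdSimplex ℝ (Y × Z))
    (d : Shat → S → ℝ) (x : X) (z : Z) (t : Shat) : |postCost PS W d x z t| ≤ distBound d := by
  by_cases h : signalLaw PS W x z = 0
  · have : ∀ s, posterior PS W s x z = 0 := fun s => by
      simp only [posterior]
      exact div_eq_zero_iff.2 (Or.inr h)
    simp [postCost, this, distBound_nonneg]
  · exact abs_sum_mul_le (posterior_mem_stdSimplex hPS hW h) (abs_le_distBound d t)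

theorem inputCost_eq (hPS : PS ∈ stdSimplex ℝ S) (hW : ∀ x s, W x s ∈ stdSimplex ℝ (Y × Z))
    (d : Shat → S → ℝ) (shat : X → Z → Shat) (x : X) :
    inputCost PS W d shat x = ∑ z, signalLaw PS W x z * postCost PS W d x z (shat x z) := by
  simp only [inputCost, postCost, Finset.mul_sum, ← mul_assoc, signalLaw_mul_posterior hPS hW]
  exact Finset.sum_comm

/-- No estimator beats the optimal symbol-by-symbol estimator: if the average input cost of the
codeword exceeds `D`, the block distortion exceeds `D` with high probability. -/
theorem nonexcess_le [Fintype Shat] (hPS : PS ∈ stdSimplex ℝ S) (hW : ∀ x s, W x s ∈ stdSimplex ℝ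
    (Y × Z))
    {d : Shat → S → ℝ} {shat : X → Z → Shat} (hshat : IsOptimalEstimator PS W d shat) {n : ℕ}
    (hn : 0 < n) (x : Fin n → X) (h : (Fin n → Z) → Fin n → Shat) {D η : ℝ} (hη : 0 < η)
    (hD : n * (D + 2 * η) ≤ ∑ i, inputCost PS W d shat (x i))
    (E : (Fin n → S) → (Fin n → Z) → Prop) [∀ s z, Decidable (E s z)]
    (hE : ∀ s z, E s z → blockDistortion d (h z) s ≤ D) :
    ∑ s, ∑ z, (if E s z then ∏ i, (PS (s i) * chanZ W (x i) (s i) (z i)) else 0) ≤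
      2 * (distBound d ^ 2 / (n * η ^ 2)) := by
  classical
  have hn' : (0 : ℝ) < n := by exact_mod_cast hn
  set K := distBound d ^ 2 / (n * η ^ 2) with hK
  have hK0 : 0 ≤ K := by positivity
  -- The margin 2η is split in two. Low distortion forces either the posterior cost of `shat` to
  -- fall nη below its mean (`E₁`), or the actual distortion to fall nη below its conditional mean
  -- given the signal (`E₂`). Optimality of `shat` links the two posterior costs.
  let E₁ : (Fin n → Z) → Prop := fun z =>
    ∑ i, postCost PS W d (x i) (z i) (shat (x i) (z i)) + n * η ≤
      ∑ i, inputCost PS W d shat (x i)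
  let E₂ : (Fin n → S) → (Fin n → Z) → Prop := fun s z =>
    ∑ i, d (h z i) (s i) + n * η ≤ ∑ i, postCost PS W d (x i) (z i) (h z i)
  have hw : ∀ (s : Fin n → S) (z : Fin n → Z),
      0 ≤ ∏ i, (PS (s i) * chanZ W (x i) (s i) (z i)) := fun s z =>
    Finset.prod_nonneg fun i _ => mul_nonneg (hPS.1 _) ((chanZ_mem_stdSimplex hW _ _).1 _)
  have hfac : ∀ (s : Fin n → S) (z : Fin n → Z),
      ∏ i, (PS (s i) * chanZ W (x i) (s i) (z i)) =
        (∏ i, signalLaw PS W (x i) (z i)) * ∏ i, posterior PS W (s i) (x i) (z i) := by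
    intro s z
    rw [← Finset.prod_mul_distrib]
    exact Finset.prod_congr rfl fun i _ => (signalLaw_mul_posterior hPS hW _ _ _).symm
  have hsig : ∀ z : Fin n → Z, 0 ≤ ∏ i, signalLaw PS W (x i) (z i) := fun z =>
    Finset.prod_nonneg fun i _ => (signalLaw_mem_stdSimplex hPS hW _).1 _
  have hcover : ∀ s z, E s z → E₁ z ∨ E₂ s z := by
    intro s z hsz
    by_contra! hcon
    obtain ⟨h1, h2⟩ := hcon
    have h1 := not_le.1 h1
    have h2 := not_le.1 h2
    have h3 : ∑ i, postCost PS W d (x i) (z i) (shat (x i) (z i)) ≤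
        ∑ i, postCost PS W d (x i) (z i) (h z i) :=
      Finset.sum_le_sum fun i _ => hshat _ _ _
    have h4 := hE s z hsz
    rw [blockDistortion, one_div, inv_mul_le_iff₀ hn'] at h4
    linarith
  have hfirst : ∑ z, ∑ s : Fin n → S,
      (if E₁ z then ∏ i, (PS (s i) * chanZ W (x i) (s i) (z i)) else 0) ≤
      K := by
    have hin : ∀ z : Fin n → Z,
        ∑ s : Fin n → S, (if E₁ z then ∏ i, (PS (s i) * chanZ W (x i) (s i) (z i)) else 0) =
          if E₁ z then ∏ i, signalLaw PS W (x i) (z i) else 0 := by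
      intro z
      split_ifs
      · exact sum_prod_eq_prod_sum fun i s => PS s * chanZ W (x i) s (z i)
      · simp
    simp only [hin]
    refine chebyshev_prod_pmf (fun i => signalLaw_mem_stdSimplex hPS hW (x i))
      (fun i z => postCost PS W d (x i) z (shat (x i) z))
      (fun i z => abs_postCost_le hPS hW d _ _ _) hη hn _ fun z hz => ?_
    simp only [← inputCost_eq hPS hW]
    rw [abs_sub_comm]
    refine le_trans ?_ (le_abs_self _)
    have : _ + _ ≤ _ := hz
    linarith
  have hsecond : ∑ z, ∑ s : Fin n → S,
      (if E₂ s z then ∏ i, (PS (s i) * chanZ W (x i) (s i) (z i)) else 0) ≤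
      K := by
    have hin : ∀ z : Fin n → Z,
        ∑ s, (if E₂ s z then ∏ i, (PS (s i) * chanZ W (x i) (s i) (z i)) else 0) ≤
          (∏ i, signalLaw PS W (x i) (z i)) * K := by
      intro z
      -- The posterior is a pmf only at signals of positive probability; the other signal sequences
      -- carry no weight.
      by_cases h0 : ∀ i, signalLaw PS W (x i) (z i) ≠ 0
      · simp only [hfac]
        have := chebyshev_prod_pmf (fun i => posterior_mem_stdSimplex hPS hW (h0 i))
          (fun i s => d (h z i) s) (fun i s => abs_le_distBound d _ _) hη hn
          (fun s => E₂ s z) (fun s hs => by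
            rw [abs_sub_comm]
            refine le_trans ?_ (le_abs_self _)
            have h5 : ∑ i, d (h z i) (s i) + n * η ≤
              ∑ i, ∑ s, posterior PS W s (x i) (z i) * d (h z i) s := hs
            linarith)
        refine le_trans (le_of_eq ?_) (mul_le_mul_of_nonneg_left this (hsig z))
        rw [Finset.mul_sum]
        exact Finset.sum_congr rfl fun s _ => by split_ifs <;> simp
      · push Not at h0
        obtain ⟨i, hi⟩ := h0
        have hz : ∏ i, signalLaw PS W (x i) (z i) = 0 :=
          Finset.prod_eq_zero (Finset.mem_univ i) hi
        simp [hfac, hz]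
    refine (Finset.sum_le_sum fun z _ => hin z).trans ?_
    rw [← Finset.sum_mul, sum_prod_eq_one fun i => signalLaw_mem_stdSimplex hPS hW (x i), one_mul]
  rw [Finset.sum_comm, two_mul]
  refine le_trans ?_ (add_le_add hfirst hsecond)
  rw [← Finset.sum_add_distrib]
  refine Finset.sum_le_sum fun z _ => ?_
  rw [← Finset.sum_add_distrib]
  refine Finset.sum_le_sum fun s _ => ?_
  have hsz := hw s z
  by_cases hEs : E s z
  · rw [if_pos hEs]
    rcases hcover s z hEs with h1 | h1
    · rw [if_pos h1]
      exact le_add_of_nonneg_right (by split_ifs <;> simp [hsz])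
    · rw [if_pos h1]
      exact le_add_of_nonneg_left (by split_ifs <;> simp [hsz])
  · rw [if_neg hEs]
    exact add_nonneg (by split_ifs <;> simp [hsz]) (by split_ifs <;> simp [hsz])

/-- If the average input cost of the codeword is below `D`, the symbol-by-symbol estimator keeps
the block distortion below `D` with high probability. -/
theorem excess_le [Fintype Shat] (hPS : PS ∈ stdSimplex ℝ S) (hW : ∀ x s, W x s ∈ stdSimplex ℝ
    (Y × Z))
    (d : Shat → S → ℝ) (shat : X → Z → Shat) {n : ℕ}
    (hn : 0 < n) (x : Fin n → X) {D η : ℝ} (hη : 0 < η)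
    (hD : ∑ i, inputCost PS W d shat (x i) ≤ n * (D - η))
    (E : (Fin n → S) → (Fin n → Z) → Prop) [∀ s z, Decidable (E s z)]
    (hE : ∀ s z, E s z → D < blockDistortion d (fun i => shat (x i) (z i)) s) :
    ∑ s, ∑ z, (if E s z then ∏ i, (PS (s i) * chanZ W (x i) (s i) (z i)) else 0) ≤
      distBound d ^ 2 / (n * η ^ 2) := by
  have hn' : (0 : ℝ) < n := by exact_mod_cast hn
  -- A pair of sequences is read as a sequence of independent pairs, so one Chebyshev bound
  -- suffices.
  rw [← Fintype.sum_prod_type', ← (Equiv.arrowProdEquivProdArrow (Fin n) (fun _ => S)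
    (fun _ => Z)).sum_comp]
  refine chebyshev_prod_pmf (fun i => stateSignal_mem_stdSimplex hPS hW (x i))
    (fun i q => d (shat (x i) q.2) q.1) (fun i q => abs_le_distBound d _ _) hη hn
    (fun q => E (fun i => (q i).1) (fun i => (q i).2)) fun q hq => ?_
  have h1 := hE _ _ hq
  rw [blockDistortion, one_div, lt_inv_mul_iff₀ hn'] at h1
  have h2 : ∀ i, ∑ q : S × Z, PS q.1 * chanZ W (x i) q.1 q.2 * d (shat (x i) q.2) q.1 =
      inputCost PS W d shat (x i) := fun i => Fintype.sum_prod_type _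
  simp only [h2]
  refine le_trans ?_ (le_abs_self _)
  linarith

end Estimation

/-! ### Feinstein's maximal code construction. -/

section Feinstein

variable {A B : Type*} [Fintype A] [Fintype B]

/-- Feinstein's maximal code lemma: codewords from `T` with disjoint decoding regions can be chosen
greedily, the region of the codeword `a` being contained in `{b | G a b}`. The regions are the
fibres of `g`. -/
theorem exists_feinstein_code {p : A → ℝ} (hp : p ∈ stdSimplex ℝ A) {v : A → B → ℝ}
    (hv : ∀ a, v a ∈ stdSimplex ℝ B) (T : A → Prop) (G : A → B → Prop) [DecidablePred T]
    [∀ a b, Decidable (G a b)] {β κ t : ℝ} (hβ : 0 ≤ β)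
    (hG : ∀ a b, G a b → ∑ a', p a' * v a' b ≤ β * v a b)
    (hgood : 1 - κ ≤ ∑ a, ∑ b, if T a ∧ G a b then p a * v a b else 0) (ht : t ≤ 1) {k : ℕ}
    (hk : κ + k * β < t) :
    ∀ j ≤ k, ∃ (φ : ℕ → A) (g : B → ℕ), ∀ m < j, T (φ m) ∧ (∀ b, g b = m → G (φ m) b) ∧
      1 - t ≤ ∑ b, if g b = m then v (φ m) b else 0 := by
  intro j
  induction j with
  | zero =>
    intro _
    have : Nonempty A := by
      by_contra h
      rw [not_nonempty_iff] at h
      simpa using hp.2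
    exact ⟨fun _ => Classical.arbitrary A, fun _ => 0, fun m hm => absurd hm (Nat.not_lt_zero m)⟩
  | succ j ih =>
    intro hj
    obtain ⟨φ, g, hφ⟩ := ih (Nat.le_of_succ_le hj)
    -- Values of `g` at least j mark outputs not yet assigned. If no further codeword fitted, the
    -- good pairs would have mass at most 1 - t plus the output mass already used. Each earlier
    -- region has output mass at most β, which contradicts κ + kβ < t.
    have hex : ∃ a, T a ∧ 1 - t ≤ ∑ b, if j ≤ g b ∧ G a b then v a b else 0 := by
      by_contra! hcon
      have hmass : ∑ b, (if g b < j then ∑ a, p a * v a b else 0) ≤ k * β := by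
        calc ∑ b, (if g b < j then ∑ a, p a * v a b else 0)
            = ∑ m ∈ Finset.range j, ∑ b, (if g b = m then ∑ a, p a * v a b else 0) := by
              rw [Finset.sum_comm]
              refine Finset.sum_congr rfl fun b _ => ?_
              rw [Finset.sum_ite_eq]
              simp
          _ ≤ ∑ m ∈ Finset.range j, β := by
              refine Finset.sum_le_sum fun m hm => ?_
              calc _ ≤ ∑ b, β * v (φ m) b := by
                    refine Finset.sum_le_sum fun b _ => ?_
                    split_ifs with h
                    · exact hG _ _ ((hφ m (Finset.mem_range.1 hm)).2.1 b h)
                    · exact mul_nonneg hβ ((hv _).1 _)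
                _ = β := by rw [← Finset.mul_sum, (hv _).2, mul_one]
          _ ≤ k * β := by
              rw [Finset.sum_const, Finset.card_range, nsmul_eq_mul]
              exact mul_le_mul_of_nonneg_right (by exact_mod_cast Nat.le_of_succ_le hj) hβ
      have hupper : ∑ a, ∑ b, (if T a ∧ G a b then p a * v a b else 0) ≤
          (1 - t) + ∑ b, (if g b < j then ∑ a, p a * v a b else 0) := by
        calc _ ≤ ∑ a, (p a * (1 - t) + ∑ b, if g b < j then p a * v a b else 0) := by
              refine Finset.sum_le_sum fun a _ => ?_
              by_cases hT : T a
              · have h1 := mul_le_mul_of_nonneg_left (hcon a hT).le (hp.1 a)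
                refine le_trans ?_ (add_le_add_left h1 _)
                rw [Finset.mul_sum, ← Finset.sum_add_distrib]
                refine Finset.sum_le_sum fun b _ => ?_
                have := mul_nonneg (hp.1 a) ((hv a).1 b)
                rcases lt_or_ge (g b) j with h1 | h1 <;> by_cases h2 : G a b <;>
                  simp only [hT, h1, h2, and_true, and_false, if_true, if_false, zero_add,
                    mul_zero] <;> first | exact this | (split_ifs <;> linarith)
              · simp only [hT, false_and, if_false, Finset.sum_const_zero]
                refine add_nonneg (mul_nonneg (hp.1 a) (by linarith))
                  (Finset.sum_nonneg fun b _ => ?_)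
                have := mul_nonneg (hp.1 a) ((hv a).1 b)
                split_ifs <;> simp [this]
          _ = _ := by
              rw [Finset.sum_add_distrib, ← Finset.sum_mul, hp.2, one_mul, Finset.sum_comm]
              congr 1
              refine Finset.sum_congr rfl fun b _ => ?_
              split_ifs <;> simp
      linarith
    obtain ⟨a, haT, ha⟩ := hex
    -- The new region is the unassigned part of {b | G a b}; the value j + 1 keeps the remaining
    -- outputs unassigned.
    refine ⟨Function.update φ j a,
      fun b => if g b < j then g b else if G a b then j else j + 1, fun m hm => ?_⟩
    rcases Nat.lt_succ_iff_lt_or_eq.1 hm with hm | rfl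
    · rw [Function.update_of_ne hm.ne]
      have hiff : ∀ b, (if g b < j then g b else if G a b then j else j + 1) = m ↔ g b = m := by
        intro b
        split_ifs <;> omega
      simp only [hiff]
      exact hφ m hm
    · rw [Function.update_self]
      have hiff : ∀ b, (if g b < m then g b else if G a b then m else m + 1) = m ↔
          m ≤ g b ∧ G a b := by
        intro b
        by_cases h2 : G a b <;> simp only [h2, if_true, if_false, and_true, and_false, iff_false] <;>
          split_ifs <;> omega
      simp only [hiff]
      exact ⟨haT, fun b hb => hb.2, ha⟩

end Feinstein

/-! ### Good codes at a fixed blocklength. -/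

section Achievability

variable {X Y Z S Shat : Type*} [Fintype X] [Fintype Y] [Fintype Z] [Fintype S] [Fintype Shat]

theorem sum_sum_pi_eq_sum_pi_prod {n : ℕ} (F : (Fin n → X) → (Fin n → Y) → ℝ) :
    ∑ x, ∑ y, F x y = ∑ q : Fin n → X × Y, F (fun i => (q i).1) (fun i => (q i).2) := by
  rw [← Fintype.sum_prod_type', ← (Equiv.arrowProdEquivProdArrow (Fin n) (fun _ => X)
    (fun _ => Y)).sum_comp]
  rfl

open Classical in
/-- Typicality of a random input sequence and its output. -/
theorem typical_prob_ge {P : X → ℝ} (hP : P ∈ stdSimplex ℝ X) {V : X → Y → ℝ}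
    (hV : ∀ x, V x ∈ stdSimplex ℝ Y) (c : X → ℝ) {M b a : ℝ} (hc : ∀ x, |c x| ≤ b)
    (hM : ∀ x y, |infoDensity P V x y| ≤ M) (ha : 0 < a) {n : ℕ} (hn : 0 < n) :
    1 - (b ^ 2 / (n * a ^ 2) + M ^ 2 / (n * a ^ 2)) ≤ ∑ x : Fin n → X, ∑ y : Fin n → Y,
      if ∑ i, c (x i) ≤ n * (∑ x, P x * c x + a) ∧ ((∀ i, V (x i) (y i) ≠ 0) ∧
        n * (mutualInfo (fun x y => P x * V x y) - a) ≤ ∑ i, infoDensity P V (x i) (y i))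
      then (∏ i, P (x i)) * ∏ i, V (x i) (y i) else 0 := by
  have hPV : (fun q : X × Y => P q.1 * V q.1 q.2) ∈ stdSimplex ℝ (X × Y) := by
    refine ⟨fun q => mul_nonneg (hP.1 _) ((hV _).1 _), ?_⟩
    rw [Fintype.sum_prod_type]
    simp only [← Finset.mul_sum, (hV _).2, mul_one, hP.2]
  have hcost := chebyshev_prod_pmf (fun _ : Fin n => hP) (fun _ => c) (fun _ => hc) ha hn
    (fun x => ¬ ∑ i, c (x i) ≤ n * (∑ x, P x * c x + a)) (by
      intro x hx
      refine le_trans ?_ (le_abs_self _)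
      rw [not_le] at hx
      simp only [Finset.sum_const, Finset.card_univ, Fintype.card_fin, nsmul_eq_mul]
      linarith)
  have hinfo := chebyshev_prod_pmf (fun _ : Fin n => hPV)
    (fun _ q => infoDensity P V q.1 q.2) (fun _ q => hM _ _) ha hn
    (fun q => ¬ n * (mutualInfo (fun x y => P x * V x y) - a) ≤
      ∑ i, infoDensity P V (q i).1 (q i).2) (by
      intro q hq
      rw [abs_sub_comm]
      refine le_trans ?_ (le_abs_self _)
      rw [not_le] at hq
      rw [mutualInfo_eq_sum_infoDensity P fun x => (hV x).2] at hq
      simp only [Finset.sum_const, Finset.card_univ, Fintype.card_fin, nsmul_eq_mul,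
        Fintype.sum_prod_type]
      linarith)
  have hcost' : ∑ x : Fin n → X, ∑ y : Fin n → Y,
      (if ¬ ∑ i, c (x i) ≤ n * (∑ x, P x * c x + a) then
        (∏ i, P (x i)) * ∏ i, V (x i) (y i) else 0) ≤ b ^ 2 / (n * a ^ 2) := by
    refine le_trans (le_of_eq (Finset.sum_congr rfl fun x _ => ?_)) hcost
    split_ifs
    · simp
    · rw [← Finset.mul_sum, sum_prod_eq_one fun i => hV (x i), mul_one]
  have hinfo' : ∑ x : Fin n → X, ∑ y : Fin n → Y,
      (if ¬ n * (mutualInfo (fun x y => P x * V x y) - a) ≤ ∑ i, infoDensity P V (x i) (y i) then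
        (∏ i, P (x i)) * ∏ i, V (x i) (y i) else 0) ≤ M ^ 2 / (n * a ^ 2) := by
    rw [sum_sum_pi_eq_sum_pi_prod]
    simpa only [Finset.prod_mul_distrib] using hinfo
  have hone : ∑ x : Fin n → X, ∑ y : Fin n → Y, (∏ i, P (x i)) * ∏ i, V (x i) (y i) = 1 := by
    have h : ∀ x : Fin n → X, ∑ y : Fin n → Y, (∏ i, P (x i)) * ∏ i, V (x i) (y i) =
        ∏ i, P (x i) := fun x => by
      rw [← Finset.mul_sum, sum_prod_eq_one fun i => hV (x i), mul_one]
    rw [Finset.sum_congr rfl fun x _ => h x]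
    exact sum_prod_eq_one fun _ => hP
  rw [← hone, sub_le_iff_le_add]
  refine le_trans ?_ (add_le_add_right (add_le_add hcost' hinfo') _)
  simp only [← Finset.sum_add_distrib]
  refine Finset.sum_le_sum fun x _ => Finset.sum_le_sum fun y _ => ?_
  have hw : 0 ≤ (∏ i, P (x i)) * ∏ i, V (x i) (y i) :=
    mul_nonneg (Finset.prod_nonneg fun i _ => hP.1 _) (Finset.prod_nonneg fun i _ => (hV _).1 _)
  by_cases h0 : ∀ i, V (x i) (y i) ≠ 0
  · by_cases h1 : ∑ i, c (x i) ≤ n * (∑ x, P x * c x + a) <;>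
    by_cases h2 : n * (mutualInfo (fun x y => P x * V x y) - a) ≤
      ∑ i, infoDensity P V (x i) (y i) <;> simp [h0, h1, h2, hw]
  · push Not at h0
    obtain ⟨i, hi⟩ := h0
    have hz : ∏ i, V (x i) (y i) = 0 := Finset.prod_eq_zero (Finset.mem_univ i) hi
    simp [hz]

theorem numMessages_pos (n : ℕ) {R : ℝ} (hR : 0 ≤ R) : 0 < numMessages n R :=
  Nat.floor_pos.2 (Real.one_le_rpow one_le_two (by positivity))

theorem numMessages_le (n : ℕ) (R : ℝ) : (numMessages n R : ℝ) ≤ (2 : ℝ) ^ ((n : ℝ) * R) :=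
  Nat.floor_le (Real.rpow_nonneg two_pos.le _)

theorem le_two_mul_numMessages (n : ℕ) {R : ℝ} (hR : 0 ≤ R) :
    (2 : ℝ) ^ ((n : ℝ) * R) ≤ 2 * numMessages n R := by
  have h1 := Nat.lt_floor_add_one ((2 : ℝ) ^ ((n : ℝ) * R))
  have h2 : (1 : ℝ) ≤ numMessages n R := by exact_mod_cast numMessages_pos n hR
  change _ < (numMessages n R : ℝ) + 1 at h1
  linarith

variable {PS : S → ℝ} {W : X → S → Y × Z → ℝ}

/-- Existence of a good code at a fixed blocklength. -/
theorem exists_good_code (hPS : PS ∈ stdSimplex ℝ S) (hW : ∀ x s, W x s ∈ stdSimplex ℝ (Y × Z))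
    (d : Shat → S → ℝ) (shat : X → Z → Shat) {P : X → ℝ} (hP : P ∈ stdSimplex ℝ X) {R D a M t : ℝ}
    (ha : 0 < a) (hR : 0 ≤ R) (hI : R + 2 * a ≤ mutualInfo (jointXY P PS W))
    (hD : expDistortion P PS W d shat + 2 * a ≤ D)
    (hM : ∀ x y, |infoDensity P (avgChan PS W) x y| ≤ M) (ht : t ≤ 1) {n : ℕ} (hn : 0 < n)
    (hsmall : distBound d ^ 2 / (n * a ^ 2) + M ^ 2 / (n * a ^ 2) + (2 : ℝ) ^ (-(n * a)) < t) :
    ∃ (φ : Fin (numMessages n R) → Fin n → X) (g : (Fin n → Y) → Fin (numMessages n R)),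
      errorProb PS W φ g ≤ t ∧
      excessProb PS W d D φ (fun x z i => shat (x i) (z i)) ≤ t := by
  classical
  have hn' : (0 : ℝ) < n := by exact_mod_cast hn
  set k := numMessages n R with hkdef
  have hk0 : 0 < k := numMessages_pos n hR
  have hk0' : (0 : ℝ) < k := by exact_mod_cast hk0
  set V := avgChan PS W with hVdef
  have hV : ∀ x, V x ∈ stdSimplex ℝ Y := avgChan_mem_stdSimplex hPS hW
  set c := inputCost PS W d shat with hcdef
  have hc : ∀ x, |c x| ≤ distBound d := fun x => by
    rw [hcdef, inputCost, ← Fintype.sum_prod_type' fun s z => PS s * chanZ W x s z * d (shat x z) s]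
    exact abs_sum_mul_le (stateSignal_mem_stdSimplex hPS hW x)
      (f := fun q : S × Z => d (shat x q.2) q.1) fun q => abs_le_distBound d _ _
  rw [jointXY_eq] at hI
  rw [expDistortion_eq] at hD
  set I := mutualInfo fun x y => P x * V x y with hIdef
  have htyp := typical_prob_ge hP hV c hc hM ha hn
  have hq := outputLaw_mem_stdSimplex hP hV
  have hcode := exists_feinstein_code (p := fun x : Fin n → X => ∏ i, P (x i))
    (v := fun x (y : Fin n → Y) => ∏ i, V (x i) (y i))
    ⟨fun x => Finset.prod_nonneg fun i _ => hP.1 _, sum_prod_eq_one fun _ => hP⟩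
    (fun x => ⟨fun y => Finset.prod_nonneg fun i _ => (hV _).1 _, sum_prod_eq_one fun i => hV _⟩)
    (fun x => ∑ i, c (x i) ≤ n * (∑ x, P x * c x + a))
    (fun x y => (∀ i, V (x i) (y i) ≠ 0) ∧ n * (I - a) ≤ ∑ i, infoDensity P V (x i) (y i))
    (Real.rpow_nonneg two_pos.le (-(n * (I - a)))) (by
      rintro x y ⟨h0, h1⟩
      refine le_trans (le_of_eq ?_) (prod_outputLaw_le hV hq.1 h0 h1)
      simp only [← Finset.prod_mul_distrib]
      exact sum_prod_eq_prod_sum fun i x => P x * V x (y i)) htyp ht (k := k) (by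
      refine lt_of_le_of_lt ?_ hsmall
      refine add_le_add_right ?_ _
      -- Of the rate gap 2a, one a is spent on typicality and the other makes this term at most
      -- 2^{-na}.
      calc (k : ℝ) * (2 : ℝ) ^ (-(n * (I - a))) ≤ (2 : ℝ) ^ (n * R) * (2 : ℝ) ^ (-(n * (I - a))) :=
            mul_le_mul_of_nonneg_right (numMessages_le n R) (Real.rpow_nonneg two_pos.le _)
        _ = (2 : ℝ) ^ (n * R + -(n * (I - a))) := (Real.rpow_add two_pos _ _).symm
        _ ≤ _ := by
            refine Real.rpow_le_rpow_of_exponent_le one_le_two ?_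
            have := mul_le_mul_of_nonneg_left hI hn'.le
            linarith) k le_rfl
  obtain ⟨φ, g, hφ⟩ := hcode
  -- Outputs outside all regions are sent to message 0, which can only reduce the error.
  refine ⟨fun m => φ m, fun y => if h : g y < k then ⟨g y, h⟩ else ⟨0, hk0⟩, ?_, ?_⟩
  · rw [errorProb_eq, one_div, inv_mul_le_iff₀ hk0']
    refine le_trans (Finset.sum_le_sum fun m _ => ?_) (le_of_eq (by simp : ∑ m : Fin k, t = k * t))
    have h1 := (hφ m m.2).2.2
    have h2 := sum_prod_eq_one fun i => hV (φ m i)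
    rw [sum_eq_sum_ite_add_sum_ite_not (fun y => g y = m)] at h2
    have h3 : ∑ y : Fin n → Y, (if (if h : g y < k then (⟨g y, h⟩ : Fin k) else ⟨0, hk0⟩) ≠ m then
        ∏ i, V (φ m i) (y i) else 0) ≤
        ∑ y : Fin n → Y, if ¬ g y = m then ∏ i, V (φ m i) (y i) else 0 := by
      refine Finset.sum_le_sum fun y _ => ?_
      have hw : 0 ≤ ∏ i, V (φ m i) (y i) := Finset.prod_nonneg fun i _ => (hV _).1 _
      by_cases h : g y = m
      · have : g y < k := h ▸ m.2
        simp [h]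
      · rw [if_pos h]
        split_ifs <;> simp [hw]
    linarith
  · rw [excessProb_eq, one_div, inv_mul_le_iff₀ hk0']
    refine le_trans (Finset.sum_le_sum fun m _ => ?_) (le_of_eq (by simp : ∑ m : Fin k, t = k * t))
    refine (excess_le hPS hW d shat hn (φ m) ha ?_ _ fun s z h => h).trans ?_
    · refine (hφ m m.2).1.trans (mul_le_mul_of_nonneg_left ?_ hn'.le)
      linarith
    · have h1 : 0 ≤ M ^ 2 / (n * a ^ 2) := by positivity
      have h2 : (0 : ℝ) ≤ (2 : ℝ) ^ (-(n * a)) := Real.rpow_nonneg two_pos.le _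
      linarith

end Achievability

/-! ### Asymptotics: achievability, strong converse, closure. -/

section Asymptotics

variable {X Y Z S Shat : Type*} [Fintype Y] [Fintype Z] [Fintype S]
variable {PS : S → ℝ} {W : X → S → Y × Z → ℝ}

theorem prob_nonneg (hPS : PS ∈ stdSimplex ℝ S) (hW : ∀ x s, W x s ∈ stdSimplex ℝ (Y × Z))
    {n k : ℕ} (φ : Fin k → Fin n → X)
    (E : Fin k → (Fin n → S) → (Fin n → Y) → (Fin n → Z) → Prop) : 0 ≤ prob PS W φ E := by
  unfold prob
  refine Finset.sum_nonneg fun m _ => Finset.sum_nonneg fun s _ => Finset.sum_nonneg fun y _ =>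
    Finset.sum_nonneg fun z _ => ?_
  split_ifs
  · exact mul_nonneg (by positivity)
      (Finset.prod_nonneg fun i _ => mul_nonneg (hPS.1 _) ((hW _ _).1 _))
  · exact le_rfl

theorem errorProb_le_one (hPS : PS ∈ stdSimplex ℝ S) (hW : ∀ x s, W x s ∈ stdSimplex ℝ (Y × Z))
    {n k : ℕ} (hk : 0 < k) (φ : Fin k → Fin n → X) (g : (Fin n → Y) → Fin k) :
    errorProb PS W φ g ≤ 1 := by
  classical
  rw [errorProb_eq, one_div, inv_mul_le_iff₀ (by exact_mod_cast hk)]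
  refine le_trans (Finset.sum_le_sum fun m _ => ?_)
    (le_of_eq (by simp : ∑ m : Fin k, (1 : ℝ) = k * 1))
  rw [← sum_prod_eq_one fun i => avgChan_mem_stdSimplex hPS hW (φ m i)]
  refine Finset.sum_le_sum fun y _ => ?_
  have := prod_pmf_nonneg (fun i => avgChan_mem_stdSimplex hPS hW (φ m i)) y
  split_ifs <;> simp [this]

theorem stateSignal_total (hPS : PS ∈ stdSimplex ℝ S) (hW : ∀ x s, W x s ∈ stdSimplex ℝ (Y × Z))
    {n : ℕ} (x : Fin n → X) :
    ∑ s : Fin n → S, ∑ z : Fin n → Z, ∏ i, (PS (s i) * chanZ W (x i) (s i) (z i)) = 1 := by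
  rw [sum_sum_prod_eq_prod_sum_sum fun i s z => PS s * chanZ W (x i) s z]
  refine Finset.prod_eq_one fun i _ => ?_
  rw [← Fintype.sum_prod_type']
  exact (stateSignal_mem_stdSimplex hPS hW (x i)).2

theorem excessProb_le_one (hPS : PS ∈ stdSimplex ℝ S) (hW : ∀ x s, W x s ∈ stdSimplex ℝ (Y × Z))
    (d : Shat → S → ℝ) (D : ℝ) {n k : ℕ} (hk : 0 < k) (φ : Fin k → Fin n → X)
    (h : (Fin n → X) → (Fin n → Z) → Fin n → Shat) : excessProb PS W d D φ h ≤ 1 := by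
  classical
  rw [excessProb_eq, one_div, inv_mul_le_iff₀ (by exact_mod_cast hk)]
  refine le_trans (Finset.sum_le_sum fun m _ => ?_)
    (le_of_eq (by simp : ∑ m : Fin k, (1 : ℝ) = k * 1))
  rw [← stateSignal_total hPS hW (φ m)]
  refine Finset.sum_le_sum fun s _ => Finset.sum_le_sum fun z _ => ?_
  have : 0 ≤ ∏ i, (PS (s i) * chanZ W (φ m i) (s i) (z i)) :=
    Finset.prod_nonneg fun i _ => mul_nonneg (hPS.1 _) ((chanZ_mem_stdSimplex hW _ _).1 _)
  split_ifs <;> simp [this]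

variable [Fintype X]

/-- Every pair strictly inside the region is achievable. -/
theorem achievable_of_lt [Fintype Shat] (hPS : PS ∈ stdSimplex ℝ S)
    (hW : ∀ x s, W x s ∈ stdSimplex ℝ (Y × Z))
    (d : Shat → S → ℝ) (shat : X → Z → Shat) {ε δ R D : ℝ} (hε : 0 ≤ ε) (hδ : 0 ≤ δ) (hR : 0 ≤ R)
    {P : X → ℝ} (hP : P ∈ stdSimplex ℝ X) (hI : R < mutualInfo (jointXY P PS W))
    (hD : expDistortion P PS W d shat < D) : Achievable PS W d ε δ R D := by
  classical
  have hX : Nonempty X := by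
    by_contra h
    rw [not_nonempty_iff] at h
    simpa using hP.2
  obtain ⟨a, ha, haI, haD⟩ : ∃ a : ℝ, 0 < a ∧ R + 2 * a ≤ mutualInfo (jointXY P PS W) ∧
      expDistortion P PS W d shat + 2 * a ≤ D := by
    refine ⟨min (mutualInfo (jointXY P PS W) - R) (D - expDistortion P PS W d shat) / 2,
      half_pos (lt_min (sub_pos.2 hI) (sub_pos.2 hD)), ?_, ?_⟩
    · linarith [min_le_left (mutualInfo (jointXY P PS W) - R) (D - expDistortion P PS W d shat)]
    · linarith [min_le_right (mutualInfo (jointXY P PS W) - R) (D - expDistortion P PS W d shat)]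
  set M := ∑ x, ∑ y, |infoDensity P (avgChan PS W) x y| with hMdef
  have hM : ∀ x y, |infoDensity P (avgChan PS W) x y| ≤ M := fun x y =>
    (Finset.single_le_sum (f := fun y => |infoDensity P (avgChan PS W) x y|)
      (fun _ _ => abs_nonneg _) (Finset.mem_univ y)).trans (Finset.single_le_sum
      (f := fun x => ∑ y, |infoDensity P (avgChan PS W) x y|)
      (fun _ _ => Finset.sum_nonneg fun _ _ => abs_nonneg _) (Finset.mem_univ x))
  let h : (n : ℕ) → (Fin n → X) → (Fin n → Z) → Fin n → Shat := fun n x z i => shat (x i) (z i)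
  let cost : (n : ℕ) → ((Fin (numMessages n R) → Fin n → X) ×
      ((Fin n → Y) → Fin (numMessages n R))) → ℝ := fun n q =>
    max (errorProb PS W q.1 q.2) (excessProb PS W d D q.1 (h n))
  -- At each blocklength there are finitely many encoder-decoder pairs. Choosing one that minimises
  -- the larger of the two probabilities yields a single sequence that serves every tolerance t.
  have hmin : ∀ n, ∃ q₀, ∀ q, cost n q₀ ≤ cost n q := fun n => by
    have : Nonempty (Fin (numMessages n R)) := ⟨⟨0, numMessages_pos n hR⟩⟩
    exact Finite.exists_min (cost n)
  choose q hq using hmin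
  have hbound : Tendsto (fun n : ℕ => distBound d ^ 2 / (n * a ^ 2) + M ^ 2 / (n * a ^ 2) +
      (2 : ℝ) ^ (-(n * a))) atTop (nhds 0) := by
    have h1 : ∀ C : ℝ, Tendsto (fun n : ℕ => C / (n * a ^ 2)) atTop (nhds 0) := fun C =>
      Tendsto.div_atTop tendsto_const_nhds
        (tendsto_natCast_atTop_atTop.atTop_mul_const (by positivity))
    have h2 : Tendsto (fun n : ℕ => (2 : ℝ) ^ (-(n * a))) atTop (nhds 0) := by
      have h3 : ∀ n : ℕ, (2 : ℝ) ^ (-(n * a)) = ((2 : ℝ) ^ (-a)) ^ n := fun n => by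
        rw [← Real.rpow_natCast, ← Real.rpow_mul two_pos.le]
        ring_nf
      simp only [h3]
      exact tendsto_pow_atTop_nhds_zero_of_lt_one (Real.rpow_nonneg two_pos.le _)
        (Real.rpow_lt_one_of_one_lt_of_neg one_lt_two (neg_lt_zero.2 ha))
    simpa using ((h1 _).add (h1 _)).add h2
  have hcost : ∀ t : ℝ, 0 < t → ∀ᶠ n in atTop, cost n (q n) ≤ t := by
    intro t ht
    filter_upwards [hbound.eventually (gt_mem_nhds (lt_min ht one_pos)), eventually_gt_atTop 0]
      with n hn hn0
    obtain ⟨φ, g, h1, h2⟩ := exists_good_code hPS hW d shat hP ha hR haI haD hM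
      (min_le_right t 1) hn0 hn
    exact (hq n (φ, g)).trans ((max_le h1 h2).trans (min_le_left _ _))
  have hlim : ∀ u : ℕ → ℝ, (∀ n, 0 ≤ u n) → (∀ n, u n ≤ cost n (q n)) →
      limsup u atTop = 0 := by
    intro u hu0 hu
    refine Tendsto.limsup_eq (tendsto_order.2 ⟨fun b hb => Eventually.of_forall fun n =>
      hb.trans_le (hu0 n), fun b hb => ?_⟩)
    filter_upwards [hcost (b / 2) (half_pos hb)] with n hn
    exact ((hu n).trans hn).trans_lt (half_lt_self hb)
  refine ⟨fun n => (q n).1, fun n => (q n).2, h, ?_, ?_⟩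
  · exact (hlim (fun n => errorProb PS W (q n).1 (q n).2)
      (fun n => prob_nonneg hPS hW _ _) fun n => le_max_left _ _).le.trans hε
  · exact (hlim (fun n => excessProb PS W d D (q n).1 (h n))
      (fun n => prob_nonneg hPS hW _ _) fun n => le_max_right _ _).le.trans hδ

/-- The finite-blocklength converse. -/
theorem one_le_errorProb_add_excessProb [Fintype Shat] (hPS : PS ∈ stdSimplex ℝ S)
    (hW : ∀ x s, W x s ∈ stdSimplex ℝ (Y × Z))
    {d : Shat → S → ℝ} {shat : X → Z → Shat} (hshat : IsOptimalEstimator PS W d shat)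
    {D r η : ℝ} (hη : 0 < η)
    (hr : ∀ P ∈ stdSimplex ℝ X, expDistortion P PS W d shat ≤ D + 2 * η →
      mutualInfo (jointXY P PS W) ≤ r)
    {n k : ℕ} (hn : 0 < n) (hk : 0 < k) (φ : Fin k → Fin n → X) (g : (Fin n → Y) → Fin k)
    (h : (Fin n → X) → (Fin n → Z) → Fin n → Shat) :
    1 ≤ errorProb PS W φ g + excessProb PS W d D φ h + 2 * (distBound d ^ 2 / (n * η ^ 2)) +
      (logBound (avgChan PS W) + Real.logb 2 n) ^ 2 / (n * η ^ 2) +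
      (n + 1 : ℝ) ^ Fintype.card X * (2 : ℝ) ^ (n * (r + η)) / k := by
  classical
  have hn' : (0 : ℝ) < n := by exact_mod_cast hn
  have hk' : (0 : ℝ) < k := by exact_mod_cast hk
  set V := avgChan PS W with hVdef
  have hV : ∀ x, V x ∈ stdSimplex ℝ Y := avgChan_mem_stdSimplex hPS hW
  set K := distBound d ^ 2 / (n * η ^ 2) with hK
  have hK0 : 0 ≤ K := by positivity
  let err : Fin k → ℝ := fun m =>
    ∑ y : Fin n → Y, if g y ≠ m then ∏ i, V (φ m i) (y i) else 0
  let succ : Fin k → ℝ := fun m =>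
    ∑ y : Fin n → Y, if g y = m then ∏ i, V (φ m i) (y i) else 0
  let exc : Fin k → ℝ := fun m => ∑ s : Fin n → S, ∑ z : Fin n → Z,
    if D < blockDistortion d (h (φ m) z) s then
      ∏ i, (PS (s i) * chanZ W (φ m i) (s i) (z i)) else 0
  have herr : k * errorProb PS W φ g = ∑ m, err m := by
    rw [errorProb_eq, ← mul_assoc, mul_one_div_cancel hk'.ne', one_mul]
  have hexc : k * excessProb PS W d D φ h = ∑ m, exc m := by
    rw [excessProb_eq, ← mul_assoc, mul_one_div_cancel hk'.ne', one_mul]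
  have hexc0 : ∀ m, 0 ≤ exc m := fun m => by
    refine Finset.sum_nonneg fun s _ => Finset.sum_nonneg fun z _ => ?_
    split_ifs
    · exact Finset.prod_nonneg fun i _ =>
        mul_nonneg (hPS.1 _) ((chanZ_mem_stdSimplex hW _ _).1 _)
    · exact le_rfl
  have herr0 : ∀ m, 0 ≤ err m := fun m => by
    refine Finset.sum_nonneg fun y _ => ?_
    split_ifs
    · exact prod_pmf_nonneg (fun i => hV (φ m i)) y
    · exact le_rfl
  have hsucc : ∀ m, succ m + err m = 1 := fun m => by
    rw [← sum_prod_eq_one fun i => hV (φ m i),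
      sum_eq_sum_ite_add_sum_ite_not (fun y => g y = m)]
  let G : Finset (Fin k) := Finset.univ.filter fun m =>
    ∑ i, inputCost PS W d shat (φ m i) < n * (D + 2 * η)
  -- A costly codeword has excess probability at least 1 - 2K, while its success probability is at
  -- most 1.
  have hbad : ∀ m, m ∉ G → succ m ≤ exc m + 2 * K := by
    intro m hm
    have hm' : n * (D + 2 * η) ≤ ∑ i, inputCost PS W d shat (φ m i) := by simpa [G] using hm
    have h1 := nonexcess_le hPS hW hshat hn (φ m) (h (φ m)) hη hm'
      (fun s z => ¬ D < blockDistortion d (h (φ m) z) s) (fun s z hsz => not_lt.1 hsz)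
    have h2 : exc m + ∑ s : Fin n → S, ∑ z : Fin n → Z,
        (if ¬ D < blockDistortion d (h (φ m) z) s then
          ∏ i, (PS (s i) * chanZ W (φ m i) (s i) (z i)) else 0) = 1 := by
      rw [← stateSignal_total hPS hW (φ m), ← Finset.sum_add_distrib]
      exact Finset.sum_congr rfl fun s _ => (sum_eq_sum_ite_add_sum_ite_not _ _).symm
    linarith [hsucc m, herr0 m]
  have hgood := sum_success_le hV hn φ g G hη (r := r) (by
    intro m hm
    have hm' : ∑ i, inputCost PS W d shat (φ m i) < n * (D + 2 * η) := by simpa [G] using hm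
    have h1 := hr (empType (φ m)) (empType_mem_stdSimplex hn _) (by
      rw [expDistortion_eq, sum_empType_mul, div_le_iff₀ hn', mul_comm]
      exact hm'.le)
    rwa [jointXY_eq] at h1)
  have hbadsum : ∑ m ∈ Gᶜ, succ m ≤ ∑ m, exc m + k * (2 * K) := by
    calc _ ≤ ∑ m ∈ Gᶜ, (exc m + 2 * K) :=
          Finset.sum_le_sum fun m hm => hbad m (Finset.mem_compl.1 hm)
      _ ≤ ∑ m, (exc m + 2 * K) :=
          Finset.sum_le_sum_of_subset_of_nonneg (Finset.subset_univ _) fun m _ _ =>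
            add_nonneg (hexc0 m) (by positivity)
      _ = _ := by simp [Finset.sum_add_distrib]
  have htotal : (k : ℝ) = ∑ m, err m + (∑ m ∈ G, succ m + ∑ m ∈ Gᶜ, succ m) := by
    rw [Finset.sum_add_sum_compl, ← Finset.sum_add_distrib,
      Finset.sum_congr rfl fun m _ => (add_comm _ _).trans (hsucc m)]
    simp
  refine le_of_mul_le_mul_left ?_ hk'
  rw [mul_add (k : ℝ), mul_add (k : ℝ), mul_add (k : ℝ), mul_add (k : ℝ),
    mul_div_cancel₀ _ hk'.ne', herr, hexc]
  have h3 : ∑ m ∈ G, succ m ≤ _ := hgood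
  linarith

/-- Writing L + log₂ n as log₂(2^L n) reduces the limit to (log y)²/y → 0. -/
theorem tendsto_sq_logb_div {L η : ℝ} (hη : 0 < η) :
    Tendsto (fun n : ℕ => (L + Real.logb 2 n) ^ 2 / (n * η ^ 2)) atTop (nhds 0) := by
  have hlog2 : 0 < Real.log 2 := Real.log_pos one_lt_two
  have hpow : (0 : ℝ) < (2 : ℝ) ^ L := Real.rpow_pos_of_pos two_pos L
  have h1 : Tendsto (fun y : ℝ => Real.log y ^ 2 / y) atTop (nhds 0) :=
    (Real.isLittleO_pow_log_id_atTop (n := 2)).tendsto_div_nhds_zero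
  have h2 : Tendsto (fun n : ℕ => (2 : ℝ) ^ L * n) atTop atTop :=
    tendsto_natCast_atTop_atTop.const_mul_atTop hpow
  have h3 := (h1.comp h2).mul_const ((2 : ℝ) ^ L / (Real.log 2 ^ 2 * η ^ 2))
  rw [zero_mul] at h3
  refine h3.congr' ?_
  filter_upwards [eventually_gt_atTop 0] with n hn
  have hn' : (0 : ℝ) < n := by exact_mod_cast hn
  have h4 : Real.log ((2 : ℝ) ^ L * n) = Real.log 2 * (L + Real.logb 2 n) := by
    rw [Real.log_mul hpow.ne' hn'.ne', Real.log_rpow two_pos, Real.logb]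
    field_simp
  simp only [Function.comp_apply, h4]
  field_simp

theorem tendsto_pow_mul_rpow_neg (c : ℕ) {η : ℝ} (hη : 0 < η) :
    Tendsto (fun n : ℕ => (n + 1 : ℝ) ^ c * (2 : ℝ) ^ (-(n * η))) atTop (nhds 0) := by
  set ρ := (2 : ℝ) ^ (-η) with hρ
  have hρ0 : 0 < ρ := Real.rpow_pos_of_pos two_pos _
  have hρ1 : ρ < 1 := Real.rpow_lt_one_of_one_lt_of_neg one_lt_two (neg_lt_zero.2 hη)
  -- The shift by one produces (n+1)^c ρ^{n+1}; the factor ρ⁻¹ restores the exponent n.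
  have h1 := ((tendsto_pow_const_mul_const_pow_of_lt_one c hρ0.le hρ1).comp
    (tendsto_add_atTop_nat 1)).mul_const ρ⁻¹
  rw [zero_mul] at h1
  refine h1.congr fun n => ?_
  have h2 : (2 : ℝ) ^ (-(n * η)) = ρ ^ n := by
    rw [hρ, ← Real.rpow_natCast, ← Real.rpow_mul two_pos.le]
    ring_nf
  rw [h2]
  simp only [Function.comp_apply]
  push_cast
  field_simp
  ring

/-- The strong converse up to a margin. -/
theorem exists_pmf_of_achievable_margin [Fintype Shat] (hPS : PS ∈ stdSimplex ℝ S)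
    (hW : ∀ x s, W x s ∈ stdSimplex ℝ (Y × Z)) {d : Shat → S → ℝ} {shat : X → Z → Shat}
    (hshat : IsOptimalEstimator PS W d shat) {ε δ R D : ℝ} (hεδ : ε + δ < 1) (hR : 0 ≤ R)
    (hach : Achievable PS W d ε δ R D) {η : ℝ} (hη : 0 < η) :
    ∃ P ∈ stdSimplex ℝ X, R - 2 * η ≤ mutualInfo (jointXY P PS W) ∧
      expDistortion P PS W d shat ≤ D + 2 * η := by
  by_contra! hcon
  obtain ⟨φ, g, h, herr, hexc⟩ := hach
  -- Error, excess and remainder each use one θ, so their total stays below ε + δ + 3θ < 1.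
  set θ := (1 - ε - δ) / 4 with hθ
  have hθ0 : 0 < θ := by rw [hθ]; linarith
  have herr' := eventually_lt_of_limsup_lt (b := ε + θ) (herr.trans_lt (by linarith))
    (isBoundedUnder_of ⟨1, fun n => errorProb_le_one hPS hW (numMessages_pos n hR) _ _⟩)
  have hexc' := eventually_lt_of_limsup_lt (b := δ + θ) (hexc.trans_lt (by linarith))
    (isBoundedUnder_of ⟨1, fun n => excessProb_le_one hPS hW d D (numMessages_pos n hR) _ _⟩)
  have hlim : Tendsto (fun n : ℕ => 2 * (distBound d ^ 2 / (n * η ^ 2)) +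
      (logBound (avgChan PS W) + Real.logb 2 n) ^ 2 / (n * η ^ 2) +
      2 * ((n + 1 : ℝ) ^ Fintype.card X * (2 : ℝ) ^ (-(n * η)))) atTop (nhds 0) := by
    have h1 : Tendsto (fun n : ℕ => distBound d ^ 2 / (n * η ^ 2)) atTop (nhds 0) :=
      Tendsto.div_atTop tendsto_const_nhds
        (tendsto_natCast_atTop_atTop.atTop_mul_const (by positivity))
    simpa using ((h1.const_mul 2).add (tendsto_sq_logb_div hη)).add
      ((tendsto_pow_mul_rpow_neg _ hη).const_mul 2)
  obtain ⟨n, h1, h2, h3, hn⟩ := (herr'.and (hexc'.and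
    ((hlim.eventually (gt_mem_nhds hθ0)).and (eventually_gt_atTop 0)))).exists
  have hk := numMessages_pos n hR
  have hk' : (0 : ℝ) < numMessages n R := by exact_mod_cast hk
  -- With this r the exponent is r + η = R - η. Dividing by the number of messages leaves 2^{-nη},
  -- up to a factor 2 from the integer part.
  have h4 := one_le_errorProb_add_excessProb hPS hW hshat hη (r := R - 2 * η)
    (fun P hP hD => not_lt.1 fun hlt => absurd hD (not_le.2 (hcon P hP hlt.le))) hn hk
    (φ n) (g n) (h n)
  have h5 : (n + 1 : ℝ) ^ Fintype.card X * (2 : ℝ) ^ (n * (R - 2 * η + η)) / numMessages n R ≤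
      2 * ((n + 1 : ℝ) ^ Fintype.card X * (2 : ℝ) ^ (-(n * η))) := by
    rw [div_le_iff₀ hk']
    have h6 : (2 : ℝ) ^ (n * (R - 2 * η + η)) = (2 : ℝ) ^ (n * R) * (2 : ℝ) ^ (-(n * η)) := by
      rw [← Real.rpow_add two_pos]
      ring_nf
    have h7 := mul_le_mul_of_nonneg_left (le_two_mul_numMessages n hR)
      (show 0 ≤ (n + 1 : ℝ) ^ Fintype.card X * (2 : ℝ) ^ (-(n * η)) by positivity)
    rw [h6]
    linarith
  linarith

theorem continuous_expDistortion (PS : S → ℝ) (W : X → S → Y × Z → ℝ) (d : Shat → S → ℝ)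
    (shat : X → Z → Shat) : Continuous fun P => expDistortion P PS W d shat := by
  simp only [expDistortion_eq]
  fun_prop

theorem continuousOn_mutualInfo_jointXY (hPS : PS ∈ stdSimplex ℝ S)
    (hW : ∀ x s, W x s ∈ stdSimplex ℝ (Y × Z)) :
    ContinuousOn (fun P => mutualInfo (jointXY P PS W)) (stdSimplex ℝ X) := by
  simp only [jointXY_eq]
  exact continuousOn_mutualInfo (avgChan_mem_stdSimplex hPS hW)

/-- Compactness of the set of input pmfs removes the margin. -/
theorem exists_pmf_of_forall_margin (hPS : PS ∈ stdSimplex ℝ S)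
    (hW : ∀ x s, W x s ∈ stdSimplex ℝ (Y × Z)) {d : Shat → S → ℝ} {shat : X → Z → Shat} {R D : ℝ}
    (hex : ∀ η : ℝ, 0 < η → ∃ P ∈ stdSimplex ℝ X, R - η ≤ mutualInfo (jointXY P PS W) ∧
      expDistortion P PS W d shat ≤ D + η) :
    ∃ P ∈ stdSimplex ℝ X, R ≤ mutualInfo (jointXY P PS W) ∧
      expDistortion P PS W d shat ≤ D := by
  -- Both inequalities pass to the limit along a convergent subsequence of pmfs for vanishing
  -- margins.
  choose P hP hI hD using fun j : ℕ => hex (1 / ((j : ℝ) + 1)) Nat.one_div_pos_of_nat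
  obtain ⟨Q, hQ, ψ, hψ, hlim⟩ := (isCompact_stdSimplex ℝ X).tendsto_subseq hP
  have hη := tendsto_one_div_add_atTop_nhds_zero_nat (𝕜 := ℝ).comp hψ.tendsto_atTop
  refine ⟨Q, hQ, ?_, ?_⟩
  · have h1 : Tendsto (fun j => mutualInfo (jointXY (P (ψ j)) PS W)) atTop
        (nhds (mutualInfo (jointXY Q PS W))) :=
      (continuousOn_mutualInfo_jointXY hPS hW Q hQ).tendsto.comp
        (tendsto_nhdsWithin_iff.2 ⟨hlim, Eventually.of_forall fun j => hP _⟩)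
    have h2 := hη.const_sub R
    rw [sub_zero] at h2
    exact le_of_tendsto_of_tendsto' h2 h1 fun j => hI (ψ j)
  · have h1 := ((continuous_expDistortion PS W d shat).tendsto Q).comp hlim
    have h2 := hη.const_add D
    rw [add_zero] at h2
    exact le_of_tendsto_of_tendsto' h1 h2 fun j => hD (ψ j)

/-- The rate inequality can be turned into an equality by moving towards the cheapest input
symbol. -/
theorem exists_pmf_mutualInfo_eq (hPS : PS ∈ stdSimplex ℝ S)
    (hW : ∀ x s, W x s ∈ stdSimplex ℝ (Y × Z)) {d : Shat → S → ℝ} {shat : X → Z → Shat} {R D : ℝ}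
    (hR : 0 ≤ R) {P : X → ℝ} (hP : P ∈ stdSimplex ℝ X) (hI : R ≤ mutualInfo (jointXY P PS W))
    (hD : expDistortion P PS W d shat ≤ D) :
    ∃ P ∈ stdSimplex ℝ X, R = mutualInfo (jointXY P PS W) ∧
      expDistortion P PS W d shat ≤ D := by
  classical
  have hX : Nonempty X := by
    by_contra h
    rw [not_nonempty_iff] at h
    simpa using hP.2
  obtain ⟨x₀, hx₀⟩ := Finite.exists_min (inputCost PS W d shat)
  -- A constant input has zero mutual information, so the intermediate value theorem applies along
  -- the segment. The cost is affine there and is least at the point mass, so it never exceeds that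
  -- of `P`.
  let path : ℝ → X → ℝ := fun t => (1 - t) • Pi.single x₀ 1 + t • P
  have hpath : ∀ t ∈ Set.Icc (0 : ℝ) 1, path t ∈ stdSimplex ℝ X := fun t ht =>
    convex_stdSimplex ℝ X (single_mem_stdSimplex ℝ x₀) hP (sub_nonneg.2 ht.2) ht.1 (by ring)
  have hcont : ContinuousOn (fun t => mutualInfo (jointXY (path t) PS W)) (Set.Icc 0 1) :=
    (continuousOn_mutualInfo_jointXY hPS hW).comp (by fun_prop) hpath
  have h0 : mutualInfo (jointXY (path 0) PS W) = 0 := by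
    have : path 0 = Pi.single x₀ 1 := by simp [path]
    rw [this, jointXY_eq]
    exact mutualInfo_single x₀ (avgChan_mem_stdSimplex hPS hW)
  have h1 : path 1 = P := by simp [path]
  obtain ⟨t, ht, hteq⟩ := intermediate_value_Icc zero_le_one hcont
    (show R ∈ Set.Icc _ _ by simpa only [h0, h1] using ⟨hR, hI⟩)
  refine ⟨path t, hpath t ht, hteq.symm, le_trans ?_ hD⟩
  have h2 : inputCost PS W d shat x₀ ≤ expDistortion P PS W d shat := by
    rw [expDistortion_eq]
    calc inputCost PS W d shat x₀ = ∑ x, P x * inputCost PS W d shat x₀ := by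
          rw [← Finset.sum_mul, hP.2, one_mul]
      _ ≤ _ := Finset.sum_le_sum fun x _ => mul_le_mul_of_nonneg_left (hx₀ x) (hP.1 x)
  have h3 : expDistortion (path t) PS W d shat =
      (1 - t) * inputCost PS W d shat x₀ + t * expDistortion P PS W d shat := by
    simp only [expDistortion_eq, path, Pi.add_apply, Pi.smul_apply, smul_eq_mul, add_mul,
      Finset.sum_add_distrib, Finset.mul_sum, mul_assoc]
    congr 1
    simp [Pi.single_apply]
  rw [h3]
  have := mul_le_mul_of_nonneg_left h2 (sub_nonneg.2 ht.2)
  linarith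

/-- The strong converse. -/
theorem exists_pmf_of_achievable [Fintype Shat] (hPS : PS ∈ stdSimplex ℝ S)
    (hW : ∀ x s, W x s ∈ stdSimplex ℝ (Y × Z)) {d : Shat → S → ℝ} {shat : X → Z → Shat}
    (hshat : IsOptimalEstimator PS W d shat) {ε δ R D : ℝ} (hεδ : ε + δ < 1) (hR : 0 ≤ R)
    (hach : Achievable PS W d ε δ R D) :
    ∃ P ∈ stdSimplex ℝ X, R ≤ mutualInfo (jointXY P PS W) ∧
      expDistortion P PS W d shat ≤ D :=
  exists_pmf_of_forall_margin hPS hW fun η hη => by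
    simpa only [mul_div_cancel₀ η (two_ne_zero' ℝ)] using
      exists_pmf_of_achievable_margin hPS hW hshat hεδ hR hach (half_pos hη)

/-- The closure of the achievable region. -/
theorem mem_closure_achievableSet_iff [Fintype Shat] (hPS : PS ∈ stdSimplex ℝ S)
    (hW : ∀ x s, W x s ∈ stdSimplex ℝ (Y × Z)) {d : Shat → S → ℝ} {shat : X → Z → Shat}
    (hshat : IsOptimalEstimator PS W d shat) {ε δ R D : ℝ} (hε : 0 ≤ ε) (hδ : 0 ≤ δ)
    (hεδ : ε + δ < 1) (hR : 0 < R) :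
    (R, D) ∈ closure (achievableSet PS W d ε δ) ↔
      ∃ P ∈ stdSimplex ℝ X, R ≤ mutualInfo (jointXY P PS W) ∧
        expDistortion P PS W d shat ≤ D := by
  rw [Metric.mem_closure_iff]
  constructor
  · intro hcl
    refine exists_pmf_of_forall_margin hPS hW fun η hη => ?_
    obtain ⟨⟨R', D'⟩, ⟨hR', hach⟩, hdist⟩ := hcl η hη
    obtain ⟨P, hP, hI, hD⟩ := exists_pmf_of_achievable hPS hW hshat hεδ hR'.le hach
    rw [Prod.dist_eq, max_lt_iff, Real.dist_eq, Real.dist_eq] at hdist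
    have h1 := abs_lt.1 hdist.1
    have h2 := abs_lt.1 hdist.2
    simp only at h1 h2 hI hD
    exact ⟨P, hP, by linarith, by linarith⟩
  · rintro ⟨P, hP, hI, hD⟩ e he
    have hm : 0 < min e R := lt_min he hR
    have hm1 := min_le_left e R
    have hm2 := min_le_right e R
    -- The minimum with R keeps the rate positive; both inequalities become strict, so the interior
    -- result applies.
    refine ⟨(R - min e R / 2, D + e / 2), ⟨?_, ?_⟩, ?_⟩
    · change 0 < R - min e R / 2
      linarith
    · exact achievable_of_lt hPS hW d shat hε hδ (by dsimp only; linarith) hP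
        (by dsimp only; linarith) (by dsimp only; linarith)
    · rw [Prod.dist_eq, max_lt_iff, Real.dist_eq, Real.dist_eq]
      constructor <;> rw [abs_lt] <;> constructor <;> dsimp only <;> linarith

end Asymptotics

end

end ISAC

theorem theorem1 {X Y Z S Shat : Type*} [Fintype X] [Fintype Y] [Fintype Z] [Fintype S]
    [Fintype Shat]
    (PS : S → ℝ) (hPS : PS ∈ stdSimplex ℝ S)
    (W : X → S → Y × Z → ℝ) (hW : ∀ x s, W x s ∈ stdSimplex ℝ (Y × Z))
    (d : Shat → S → ℝ)
    (shat : X → Z → Shat) (hshat : ISAC.IsOptimalEstimator PS W d shat)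
    (ε δ : ℝ) (hε : 0 ≤ ε) (hδ : 0 ≤ δ) (hεδ : ε + δ < 1)
    (R D : ℝ) (hR : 0 < R) :
    -- characterization of the (closed) region of achievable pairs
    ((R, D) ∈ closure (ISAC.achievableSet PS W d ε δ) ↔
      ∃ P ∈ stdSimplex ℝ X, R ≤ ISAC.mutualInfo (ISAC.jointXY P PS W) ∧
        ISAC.expDistortion P PS W d shat ≤ D) ∧
    -- the same with equality in the rate condition
    ((R, D) ∈ closure (ISAC.achievableSet PS W d ε δ) ↔
      ∃ P ∈ stdSimplex ℝ X, R = ISAC.mutualInfo (ISAC.jointXY P PS W) ∧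
        ISAC.expDistortion P PS W d shat ≤ D) ∧
    -- strong converse, without taking the closure
    (ISAC.Achievable PS W d ε δ R D →
      ∃ P ∈ stdSimplex ℝ X, R = ISAC.mutualInfo (ISAC.jointXY P PS W) ∧
        ISAC.expDistortion P PS W d shat ≤ D) ∧
    -- achievability away from the boundary, without taking the closure
    ((∃ P ∈ stdSimplex ℝ X, R < ISAC.mutualInfo (ISAC.jointXY P PS W) ∧
        ISAC.expDistortion P PS W d shat < D) →
      ISAC.Achievable PS W d ε δ R D) := by
  have hclosure := ISAC.mem_closure_achievableSet_iff (D := D) hPS hW hshat hε hδ hεδ hR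
  have heq : (∃ P ∈ stdSimplex ℝ X, R ≤ ISAC.mutualInfo (ISAC.jointXY P PS W) ∧
        ISAC.expDistortion P PS W d shat ≤ D) ↔
      ∃ P ∈ stdSimplex ℝ X, R = ISAC.mutualInfo (ISAC.jointXY P PS W) ∧
        ISAC.expDistortion P PS W d shat ≤ D :=
    ⟨fun ⟨_, hP, hI, hD⟩ => ISAC.exists_pmf_mutualInfo_eq hPS hW hR.le hP hI hD,
      fun ⟨P, hP, hI, hD⟩ => ⟨P, hP, hI.le, hD⟩⟩
  refine ⟨hclosure, hclosure.trans heq, fun hach => ?_, ?_⟩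
  · exact heq.1 (ISAC.exists_pmf_of_achievable hPS hW hshat hεδ hR.le hach)
  · rintro ⟨P, hP, hI, hD⟩
    exact ISAC.achievable_of_lt hPS hW d shat hε hδ hR.le hP hI hD
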